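/- **Lemma (Weyl's law).** Let $\Gamma$ be a compact metric graph: a finite vertex set $V$, a finite edge set $E$ (loops and multiple edges are allowed), and for every edge $e$ a length $0<L_e<\infty$, the edge $e$ being identified with the interval $[0,L_e]$ whose end points are attached to vertices. At every vertex $v$ one of the following two conditions is prescribed for functions $f=(f_e)_{e\in E}$, $f_e:[0,L_e]\to\mathbb C$: * Neumann: the values of $f$ at all edge ends attached to $v$ agree, and $\sum_{e\sim v}\frac{df_e}{dx}(v)=0$, where the derivatives are taken in the direction from $v$ into the edge and a loop at $v$ contributes two terms; * Dirichlet: $f_e(v)=0$ for every edge end attached to $v$. A real number $\lambda$ is an eigenvalue of $\Gamma$ if there is a nonzero $f$, twice differentiable on every edge, which satisfies $-f_e''=\lambda f_e$ on every edge $e$ and the prescribed condition at every vertex; its multiplicity is the dimension of the space of all such $f$ (together with $0$). For $k\ge 0$ let $N(k)$ be the number of eigenvalues $\lambda\le k^2$, counted with multiplicity, and let $\mathcal L=\sum_{e\in E}L_e$ be the total length. Then $N(k)$ is finite, $$N(k)=\frac{\mathcal L}{\pi}\,k+O(1),$$ where the remainder is bounded above and below by constants independent of $k\ge 0$, and more precisely,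 for all $k\ge 0$, $$\frac{\mathcal L}{\pi}\,k-|E|\;\le\; N(k)\;\le\;\frac{\mathcal L}{\pi}\,k+|V| .$$ -/

import Mathlib

/-- The two kinds of vertex conditions. -/
inductive VertexCondition where
  | neumann
  | dirichlet

/-- A metric graph with vertex set `V` and edge set `E`, with a Neumann or Dirichlet condition at
every vertex. Loops and multiple edges are allowed. The edge `e` is identified with the interval
`[0, length e]`, the point `0` being glued to the vertex `src e` and the point `length e` to
`tgt e`. It is compact as soon as `E` is finite. -/
structure QuantumGraph (V E : Type*) where
  src : E → V
  tgt : E → V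
  length : E → ℝ
  length_pos : ∀ e, 0 < length e
  cond : V → VertexCondition

namespace QuantumGraph

variable {V E : Type*} (Γ : QuantumGraph V E)

/-- A (complex valued) function on the graph: a collection of functions on the individual edges. -/
abbrev Fn : Type _ := (e : E) → Set.Icc (0 : ℝ) (Γ.length e) → ℂ

/-- The two end points of the edge `e`, as points of `[0, length e]`: `false` stands for `0` and
`true` for `length e`. -/
def endPoint (e : E) (b : Bool) : Set.Icc (0 : ℝ) (Γ.length e) :=
  if b then ⟨Γ.length e, (Γ.length_pos e).le, le_rfl⟩ else ⟨0, le_rfl, (Γ.length_pos e).le⟩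

/-- The vertex to which an edge end is attached. An edge end is a pair `(e, b)`, so that a loop has
two ends attached to its vertex. -/
def endVertex (h : E × Bool) : V := if h.2 then Γ.tgt h.1 else Γ.src h.1

/-- The function on the edge `e`, extended to the real line so that one can differentiate it
(within `[0, length e]` only, where the extension plays no role). -/
noncomputable def onEdge (f : Γ.Fn) (e : E) : ℝ → ℂ := Set.IccExtend (Γ.length_pos e).le (f e)

/-- Differentiability along every edge, one-sided at the ends. -/
def Diff (f : Γ.Fn) : Prop :=
  ∀ e, DifferentiableOn ℝ (Γ.onEdge f e) (Set.Icc 0 (Γ.length e))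

/-- The derivative `df/dx` along every edge, one-sided at the ends. -/
noncomputable def D (f : Γ.Fn) : Γ.Fn :=
  fun e x => derivWithin (Γ.onEdge f e) (Set.Icc 0 (Γ.length e)) x

/-- The value of `f` at an edge end. -/
def endValue (f : Γ.Fn) (h : E × Bool) : ℂ := f h.1 (Γ.endPoint h.1 h.2)

/-- The derivative of `f` at an edge end, in the direction from the vertex into the edge. -/
noncomputable def endDeriv (f : Γ.Fn) (h : E × Bool) : ℂ :=
  if h.2 then -Γ.D f h.1 (Γ.endPoint h.1 h.2) else Γ.D f h.1 (Γ.endPoint h.1 h.2)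

open Classical in
/-- The condition `c` at the vertex `v`. Neumann: the values at all edge ends attached to `v` agree
and the derivatives into the edges sum to zero. Dirichlet: all values at `v` vanish. -/
def Satisfies [Fintype E] (f : Γ.Fn) (v : V) : VertexCondition → Prop
  | .neumann =>
      (∀ h h' : E × Bool, Γ.endVertex h = v → Γ.endVertex h' = v →
        Γ.endValue f h = Γ.endValue f h') ∧
      ∑ h : E × Bool with Γ.endVertex h = v, Γ.endDeriv f h = 0
  | .dirichlet => ∀ h : E × Bool, Γ.endVertex h = v → Γ.endValue f h = 0

variable {Γ}

lemma onEdge_add (f g : Γ.Fn) (e : E) : Γ.onEdge (f + g) e = Γ.onEdge f e + Γ.onEdge g e := rfl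

lemma onEdge_smul (c : ℂ) (f : Γ.Fn) (e : E) : Γ.onEdge (c • f) e = c • Γ.onEdge f e := rfl

lemma Diff.add {f g : Γ.Fn} (hf : Γ.Diff f) (hg : Γ.Diff g) : Γ.Diff (f + g) := fun e => by
  rw [onEdge_add]; exact (hf e).add (hg e)

lemma Diff.smul {f : Γ.Fn} (c : ℂ) (hf : Γ.Diff f) : Γ.Diff (c • f) := fun e => by
  rw [onEdge_smul]; exact (hf e).const_smul c

lemma D_add {f g : Γ.Fn} (hf : Γ.Diff f) (hg : Γ.Diff g) : Γ.D (f + g) = Γ.D f + Γ.D g := by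
  funext e x
  simp only [D, onEdge_add, Pi.add_apply]
  exact derivWithin_add (hf e x x.2) (hg e x x.2)

lemma D_smul {f : Γ.Fn} (c : ℂ) (hf : Γ.Diff f) : Γ.D (c • f) = c • Γ.D f := by
  funext e x
  simp only [D, onEdge_smul, Pi.smul_apply]
  exact derivWithin_const_smul c (hf e x x.2)

lemma D_zero : Γ.D 0 = 0 := by
  funext e x
  have : Γ.onEdge 0 e = fun _ => (0 : ℂ) := rfl
  simp [D, this]

lemma diff_zero : Γ.Diff 0 := fun e => by
  have : Γ.onEdge 0 e = fun _ => (0 : ℂ) := rfl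
  rw [this]; exact differentiableOn_const 0

lemma endDeriv_add {f g : Γ.Fn} (hf : Γ.Diff f) (hg : Γ.Diff g) (h : E × Bool) :
    Γ.endDeriv (f + g) h = Γ.endDeriv f h + Γ.endDeriv g h := by
  unfold endDeriv
  rw [D_add hf hg]
  split_ifs <;> simp [add_comm]

lemma endDeriv_smul {f : Γ.Fn} (c : ℂ) (hf : Γ.Diff f) (h : E × Bool) :
    Γ.endDeriv (c • f) h = c * Γ.endDeriv f h := by
  unfold endDeriv
  rw [D_smul c hf]
  split_ifs <;> simp

lemma Satisfies.add [Fintype E] {f g : Γ.Fn} (hf : Γ.Diff f) (hg : Γ.Diff g) {v : V}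
    {c : VertexCondition} (h1 : Γ.Satisfies f v c) (h2 : Γ.Satisfies g v c) :
    Γ.Satisfies (f + g) v c := by
  cases c with
  | neumann =>
    refine ⟨fun h h' e e' => ?_, ?_⟩
    · exact congrArg₂ (· + ·) (h1.1 h h' e e') (h2.1 h h' e e')
    · simp only [endDeriv_add hf hg, Finset.sum_add_distrib, h1.2, h2.2, add_zero]
  | dirichlet =>
    intro h e
    exact (congrArg₂ (· + ·) (h1 h e) (h2 h e)).trans (add_zero 0)

lemma Satisfies.smul [Fintype E] {f : Γ.Fn} (a : ℂ) (hf : Γ.Diff f) {v : V}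
    {c : VertexCondition} (h1 : Γ.Satisfies f v c) : Γ.Satisfies (a • f) v c := by
  cases c with
  | neumann =>
    refine ⟨fun h h' e e' => ?_, ?_⟩
    · exact congrArg (a * ·) (h1.1 h h' e e')
    · simp only [endDeriv_smul a hf, ← Finset.mul_sum, h1.2, mul_zero]
  | dirichlet =>
    intro h e
    exact (congrArg (a * ·) (h1 h e)).trans (mul_zero a)

lemma satisfies_zero [Fintype E] (v : V) (c : VertexCondition) : Γ.Satisfies 0 v c := by
  cases c with
  | neumann => exact ⟨fun _ _ _ _ => rfl, by simp [endDeriv, D_zero]⟩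
  | dirichlet => exact fun _ _ => rfl

variable (Γ) [Fintype E]

/-- The solution space, for the number `lam`, of the eigenvalue equation `-f'' = lam f` on every
edge together with the prescribed condition at every vertex. -/
noncomputable def eigenspace (lam : ℝ) : Submodule ℂ Γ.Fn where
  carrier := {f | Γ.Diff f ∧ Γ.Diff (Γ.D f) ∧
    (∀ e x, -Γ.D (Γ.D f) e x = (lam : ℂ) * f e x) ∧ ∀ v, Γ.Satisfies f v (Γ.cond v)}
  add_mem' := by
    rintro f g ⟨f1, f2, f3, f4⟩ ⟨g1, g2, g3, g4⟩
    refine ⟨f1.add g1, ?_, fun e x => ?_, fun v => (f4 v).add f1 g1 (g4 v)⟩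
    · rw [D_add f1 g1]; exact f2.add g2
    · rw [D_add f1 g1, D_add f2 g2]
      simp only [Pi.add_apply, neg_add, f3, g3, mul_add]
  zero_mem' := by
    refine ⟨diff_zero, ?_, fun e x => ?_, fun v => satisfies_zero v _⟩
    · rw [D_zero]; exact diff_zero
    · rw [D_zero, D_zero]; simp
  smul_mem' := by
    rintro c f ⟨f1, f2, f3, f4⟩
    refine ⟨f1.smul c, ?_, fun e x => ?_, fun v => (f4 v).smul c f1⟩
    · rw [D_smul c f1]; exact f2.smul c
    · rw [D_smul c f1, D_smul c f2]
      simp only [Pi.smul_apply, smul_eq_mul, ← mul_neg, f3]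
      ring

/-- The set of eigenvalues. -/
def eigenvalues : Set ℝ := {lam | Γ.eigenspace lam ≠ ⊥}

/-- The counting function `N(k)`: the number of eigenvalues `lam ≤ k²`, each counted with its
multiplicity. -/
noncomputable def counting (k : ℝ) : ℕ :=
  ∑ᶠ lam ∈ Γ.eigenvalues ∩ Set.Iic (k ^ 2), Module.finrank ℂ (Γ.eigenspace lam)

/-- The total length of the edges. -/
noncomputable def totalLength : ℝ := ∑ e, Γ.length e

end QuantumGraph

/-! Fix `k` and cut each edge into equal pieces of length `l` with `k * l < π`. For `0 ≤ t ≤ k` a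
solution of `f'' = -t² f` on a piece is then determined by its two end values, so an eigenfunction
for `t²` is encoded by its values at the division points. The energies of the pieces add up to a
Hermitian form on these values, with operator `nodeOp`; its kernel is the eigenspace for `t²`
(`kerEquivEigenspace`), since the equation at a node says that the outgoing derivatives cancel.

On each piece the energy decreases strictly in `t` (`pieceForm_le`) and is nonnegative at `t = 0`.
The ordered eigenvalues of `nodeOp` are therefore continuous and strictly decreasing, start
nonnegative, and each crosses zero at most once. Counting crossings
(`sum_finrank_ker_eq_card_eigenvalues_nonpos`) and excluding negative eigenvalues of the graph
(`eigenspace_eq_bot_of_neg`), `N(k)` is exactly the number of nonpositive eigenvalues of `nodeOp` at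
`k`, for every admissible subdivision (`counting_eq_card_eigenvalues_nonpos`).

Both bounds come from choosing the subdivision. With `⌊k L_e / π⌋ + 1` pieces per edge, the
dimension of the node space gives the upper bound. With `2 m_e` pieces, `m_e = ⌊k L_e / π⌋`, the
values supported at odd division points form a space of dimension `∑ m_e` on which the form is
nonpositive, which gives the lower bound. -/

section SymmetricOperators

open Module Set

/-! ### Min-max comparison and zero crossings of eigenvalue curves. -/

section SymmetricFamilies

variable {F : Type*} [NormedAddCommGroup F] [InnerProductSpace ℂ F] [FiniteDimensional ℂ F]

open scoped InnerProductSpace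

/-- Fewer linear conditions than dimensions have a common nonzero solution. -/
lemma exists_ne_zero_of_card_lt_finrank {K M ι : Type*} [Field K] [AddCommGroup M] [Module K M]
    [FiniteDimensional K M] [Fintype ι] (φ : ι → M →ₗ[K] K) (h : Fintype.card ι < finrank K M) :
    ∃ x ≠ 0, ∀ i, φ i x = 0 := by
  have hk : LinearMap.ker (LinearMap.pi φ) ≠ ⊥ :=
    LinearMap.ker_ne_bot_of_finrank_lt (by simpa using h)
  obtain ⟨x, hx, hx0⟩ := Submodule.exists_mem_ne_zero_of_ne_bot hk
  refine ⟨x, hx0, fun i => ?_⟩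
  have := LinearMap.mem_ker.1 hx
  exact congrFun this i

namespace LinearMap.IsSymmetric

variable {S T : F →ₗ[ℂ] F} (hS : S.IsSymmetric) (hT : T.IsSymmetric) {n : ℕ}
  (hn : finrank ℂ F = n)

/-- The quadratic form of a symmetric operator in an orthonormal basis of eigenvectors. -/
lemma re_inner_apply_self_eq_sum (x : F) :
    (⟪x, T x⟫_ℂ).re =
      ∑ i, hT.eigenvalues hn i * ‖(hT.eigenvectorBasis hn).repr x i‖ ^ 2 := by
  rw [← (hT.eigenvectorBasis hn).repr.inner_map_map, PiLp.inner_apply, Complex.re_sum]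
  refine Finset.sum_congr rfl fun i _ => ?_
  rw [hT.eigenvectorBasis_apply_self_apply hn]
  generalize (hT.eigenvectorBasis hn).repr x i = z
  simp only [RCLike.inner_apply, RCLike.ofReal_eq_complex_ofReal]
  rw [mul_assoc, Complex.mul_conj, ← Complex.ofReal_mul, Complex.ofReal_re, Complex.normSq_eq_norm_sq]

lemma norm_sq_eq_sum_repr (x : F) :
    ‖x‖ ^ 2 = ∑ i, ‖(hT.eigenvectorBasis hn).repr x i‖ ^ 2 := by
  rw [← (hT.eigenvectorBasis hn).repr.norm_map, EuclideanSpace.norm_sq_eq]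

/-- A vector on which the `j`-th eigenvalues of two symmetric operators can be compared. -/
lemma exists_eigenvalue_comparison (j : Fin n) :
    ∃ x ≠ 0, hS.eigenvalues hn j * ‖x‖ ^ 2 ≤ (⟪x, S x⟫_ℂ).re ∧
      (⟪x, T x⟫_ℂ).re ≤ hT.eigenvalues hn j * ‖x‖ ^ 2 := by
  -- Eigenvalues are sorted decreasingly. Killing the `S`-coordinates above `j` and the
  -- `T`-coordinates below `j` costs only `n - 1` conditions, so a nonzero vector survives.
  obtain ⟨x, hx0, hx⟩ := exists_ne_zero_of_card_lt_finrank (K := ℂ) (M := F)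
    (ι := {i : Fin n // i ≠ j})
    (fun i => if j < i then
      (hS.eigenvectorBasis hn).toBasis.coord i.1
      else (hT.eigenvectorBasis hn).toBasis.coord i.1)
    (by
      rw [hn, Fintype.card_subtype_compl, Fintype.card_fin, Fintype.card_subtype_eq]
      have := j.pos
      omega)
  refine ⟨x, hx0, ?_, ?_⟩
  · rw [hS.re_inner_apply_self_eq_sum hn, hS.norm_sq_eq_sum_repr hn, Finset.mul_sum]
    refine Finset.sum_le_sum fun i _ => ?_
    by_cases hij : j < i
    · have := hx ⟨i, hij.ne'⟩
      simp only [hij, if_true] at this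
      have h0 : (hS.eigenvectorBasis hn).repr x i = 0 := by simpa using this
      simp [h0]
    · gcongr
      exact hS.eigenvalues_antitone hn (not_lt.1 hij)
  · rw [hT.re_inner_apply_self_eq_sum hn, hT.norm_sq_eq_sum_repr hn, Finset.mul_sum]
    refine Finset.sum_le_sum fun i _ => ?_
    by_cases hij : i < j
    · have := hx ⟨i, hij.ne⟩
      simp only [hij.not_gt, if_false] at this
      have h0 : (hT.eigenvectorBasis hn).repr x i = 0 := by simpa using this
      simp [h0]
    · gcongr
      exact hT.eigenvalues_antitone hn (not_lt.1 hij)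

/-- Strictness survives because the comparison is made on one explicit nonzero vector. -/
lemma eigenvalues_lt_of_form_lt
    (h : ∀ x ≠ 0, (⟪x, S x⟫_ℂ).re < (⟪x, T x⟫_ℂ).re) (j : Fin n) :
    hS.eigenvalues hn j < hT.eigenvalues hn j := by
  obtain ⟨x, hx0, h1, h2⟩ := hS.exists_eigenvalue_comparison hT hn j
  have : 0 < ‖x‖ ^ 2 := by positivity
  have := (h1.trans_lt (h x hx0)).trans_le h2
  exact lt_of_mul_lt_mul_right this (by positivity)

lemma eigenvalues_le_add_of_form_le {ε : ℝ}
    (h : ∀ x, (⟪x, S x⟫_ℂ).re ≤ (⟪x, T x⟫_ℂ).re + ε * ‖x‖ ^ 2) (j : Fin n) :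
    hS.eigenvalues hn j ≤ hT.eigenvalues hn j + ε := by
  obtain ⟨x, hx0, h1, h2⟩ := hS.exists_eigenvalue_comparison hT hn j
  have : 0 < ‖x‖ ^ 2 := by positivity
  refine le_of_mul_le_mul_right ?_ this
  linarith [h x]

lemma eigenvalues_nonneg_of_form_nonneg (h : ∀ x, 0 ≤ (⟪x, T x⟫_ℂ).re) (j : Fin n) :
    0 ≤ hT.eigenvalues hn j := by
  obtain ⟨x, hx0, -, h2⟩ := hT.exists_eigenvalue_comparison hT hn j
  have h3 : 0 < ‖x‖ ^ 2 := by positivity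
  exact nonneg_of_mul_nonneg_left ((h x).trans h2) h3

/-- The dimension of a subspace on which the form is nonpositive is at most the number of
nonpositive eigenvalues. -/
lemma finrank_le_card_eigenvalues_nonpos (U : Submodule ℂ F)
    (hU : ∀ x ∈ U, (⟪x, T x⟫_ℂ).re ≤ 0) :
    finrank ℂ U ≤ Finset.card {j | hT.eigenvalues hn j ≤ 0} := by
  by_contra! hlt
  -- If `U` were too large, it would contain a nonzero vector all of whose components lie in
  -- eigendirections with positive eigenvalue.
  obtain ⟨x, hx0, hx⟩ := exists_ne_zero_of_card_lt_finrank (K := ℂ) (M := U)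
    (ι := {j // hT.eigenvalues hn j ≤ 0})
    (fun i => (hT.eigenvectorBasis hn).toBasis.coord i.1 ∘ₗ U.subtype)
    (by rwa [Fintype.card_subtype])
  have hx' : ∀ i, hT.eigenvalues hn i ≤ 0 → (hT.eigenvectorBasis hn).repr (x : F) i = 0 :=
    fun i hi => by simpa using hx ⟨i, hi⟩
  have h0 : ∀ i, 0 ≤ hT.eigenvalues hn i * ‖(hT.eigenvectorBasis hn).repr (x : F) i‖ ^ 2 := by
    intro i
    rcases le_or_gt (hT.eigenvalues hn i) 0 with hi | hi
    · simp [hx' i hi]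
    · positivity
  have hsum := hU x x.2
  rw [hT.re_inner_apply_self_eq_sum hn] at hsum
  have hz := (Finset.sum_eq_zero_iff_of_nonneg fun i _ => h0 i).1
    (le_antisymm hsum (Finset.sum_nonneg fun i _ => h0 i))
  apply hx0
  rw [← Subtype.coe_inj, Submodule.coe_zero, ← (hT.eigenvectorBasis hn).repr.map_eq_zero_iff]
  ext i
  rcases le_or_gt (hT.eigenvalues hn i) 0 with hi | hi
  · exact hx' i hi
  · simpa [hi.ne'] using hz i (Finset.mem_univ i)

lemma card_eigenvalues_eq_zero :
    Finset.card {j | hT.eigenvalues hn j = 0} = finrank ℂ (LinearMap.ker T) := by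
  have := hT.card_filter_eigenvalues_eq hn 0
  rw [Module.End.eigenspace_zero] at this
  rw [← this]
  congr 1
  ext j
  simp

end LinearMap.IsSymmetric

variable {T : ℝ → F →ₗ[ℂ] F} (hT : ∀ t, (T t).IsSymmetric) {n : ℕ} (hn : finrank ℂ F = n) {k : ℝ}

/-- Eigenvalues move by no more than the perturbation in operator norm; in finite dimension
pointwise continuity gives norm continuity. -/
lemma continuousOn_eigenvalues {s : Set ℝ} (hc : ∀ x, ContinuousOn (fun t => T t x) s)
    (j : Fin n) : ContinuousOn (fun t => (hT t).eigenvalues hn j) s := by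
  have hc' : ContinuousOn (fun t => (T t).toContinuousLinearMap) s :=
    continuousOn_clm_apply.2 fun x => hc x
  rw [Metric.continuousOn_iff] at hc' ⊢
  intro t ht ε hε
  obtain ⟨δ, hδ, H⟩ := hc' t ht (ε / 2) (half_pos hε)
  refine ⟨δ, hδ, fun s hs hst => ?_⟩
  have hd := H s hs hst
  have key : ∀ a b : ℝ, dist ((T a).toContinuousLinearMap) ((T b).toContinuousLinearMap) < ε / 2 →
      ∀ x, (⟪x, T a x⟫_ℂ).re ≤ (⟪x, T b x⟫_ℂ).re + ε / 2 * ‖x‖ ^ 2 := by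
    intro a b hab x
    rw [dist_eq_norm] at hab
    have h1 : (⟪x, T a x⟫_ℂ).re - (⟪x, T b x⟫_ℂ).re = (⟪x, T a x - T b x⟫_ℂ).re := by
      rw [inner_sub_right, Complex.sub_re]
    have h2 : (⟪x, T a x - T b x⟫_ℂ).re ≤ ‖x‖ * ‖T a x - T b x‖ :=
      (Complex.re_le_norm _).trans (norm_inner_le_norm _ _)
    have h3 : ‖T a x - T b x‖ ≤ ε / 2 * ‖x‖ :=
      ((((T a).toContinuousLinearMap) - ((T b).toContinuousLinearMap)).le_opNorm x).trans
        (by gcongr)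
    nlinarith [norm_nonneg x]
  have h1 := (hT s).eigenvalues_le_add_of_form_le (hT t) hn (key s t hd) j
  have h2 := (hT t).eigenvalues_le_add_of_form_le (hT s) hn (key t s (by rwa [dist_comm])) j
  rw [Real.dist_eq, abs_lt]
  constructor <;> linarith

/-- For a continuous, strictly decreasing family of symmetric operators that starts from a
nonnegative one, the dimensions of the kernels up to time `k` add up to the number of nonpositive
eigenvalues at time `k`. -/
theorem sum_finrank_ker_eq_card_eigenvalues_nonpos (hk : 0 ≤ k)
    (hc : ∀ x, ContinuousOn (fun t => T t x) (Icc 0 k))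
    (hlt : ∀ s ∈ Icc 0 k, ∀ t ∈ Icc 0 k, s < t → ∀ x ≠ 0, (⟪x, T t x⟫_ℂ).re < (⟪x, T s x⟫_ℂ).re)
    (h0 : ∀ x, 0 ≤ (⟪x, T 0 x⟫_ℂ).re) :
    {t ∈ Icc 0 k | LinearMap.ker (T t) ≠ ⊥}.Finite ∧
    ∑ᶠ t ∈ {t ∈ Icc 0 k | LinearMap.ker (T t) ≠ ⊥}, finrank ℂ (LinearMap.ker (T t)) =
      Finset.card {j | (hT k).eigenvalues hn j ≤ 0} := by
  classical
  have hanti : ∀ j : Fin n, ∀ s ∈ Icc 0 k, ∀ t ∈ Icc 0 k, s < t →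
      (hT t).eigenvalues hn j < (hT s).eigenvalues hn j :=
    fun j s hs t ht hst => (hT t).eigenvalues_lt_of_form_lt (hT s) hn (hlt s hs t ht hst) j
  have huniq : ∀ j : Fin n, ∀ s ∈ Icc 0 k, ∀ t ∈ Icc 0 k, (hT s).eigenvalues hn j = 0 →
      (hT t).eigenvalues hn j = 0 → s = t := by
    intro j s hs t ht h1 h2
    rcases lt_trichotomy s t with h | h | h
    · linarith [hanti j s hs t ht h]
    · exact h
    · linarith [hanti j t ht s hs h]
  have hex : ∀ j : Fin n, (hT k).eigenvalues hn j ≤ 0 →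
      ∃ t ∈ Icc 0 k, (hT t).eigenvalues hn j = 0 := by
    intro j hj
    have := intermediate_value_Icc' hk (continuousOn_eigenvalues hT hn hc j)
      ⟨hj, (hT 0).eigenvalues_nonneg_of_form_nonneg hn h0 j⟩
    obtain ⟨t, ht, h⟩ := this
    exact ⟨t, ht, h⟩
  have hneg : ∀ j : Fin n, ∀ t ∈ Icc 0 k, (hT t).eigenvalues hn j = 0 →
      (hT k).eigenvalues hn j ≤ 0 := by
    intro j t ht h
    rcases ht.2.eq_or_lt with rfl | h'
    · exact h.le
    · exact ((hanti j t ht k ⟨hk, le_rfl⟩ h').trans_eq h).le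
  -- `τ j` is the unique crossing time of the `j`-th curve; the kernel at time `t` has dimension the
  -- size of the fibre of `τ` over `t`.
  choose! τ hτ hτ0 using hex
  set J : Finset (Fin n) := {j | (hT k).eigenvalues hn j ≤ 0} with hJ
  have hmem : ∀ j, j ∈ J ↔ (hT k).eigenvalues hn j ≤ 0 := by simp [hJ]
  have hfib : ∀ t ∈ Icc 0 k, finrank ℂ (LinearMap.ker (T t)) =
      (J.filter fun j => τ j = t).card := by
    intro t ht
    rw [← (hT t).card_eigenvalues_eq_zero hn]
    congr 1
    ext j
    simp only [Finset.mem_filter, Finset.mem_univ, true_and, hmem]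
    constructor
    · intro h
      have hj := hneg j t ht h
      exact ⟨hj, huniq j _ (hτ j hj) t ht (hτ0 j hj) h⟩
    · rintro ⟨hj, rfl⟩
      exact hτ0 j hj
  have hZ : {t ∈ Icc 0 k | LinearMap.ker (T t) ≠ ⊥} = (J.image τ : Finset ℝ) := by
    ext t
    simp only [mem_ofPred_eq, Finset.coe_image, mem_image, Finset.mem_coe]
    constructor
    · rintro ⟨ht, hker⟩
      have : finrank ℂ (LinearMap.ker (T t)) ≠ 0 := by
        rwa [Ne, Submodule.finrank_eq_zero]
      rw [hfib t ht, Ne, Finset.card_eq_zero, ← Ne, ← Finset.nonempty_iff_ne_empty] at this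
      obtain ⟨j, hj⟩ := this
      exact ⟨j, (Finset.mem_filter.1 hj).1, (Finset.mem_filter.1 hj).2⟩
    · rintro ⟨j, hj, rfl⟩
      have ht := hτ j ((hmem j).1 hj)
      refine ⟨ht, ?_⟩
      rw [Ne, ← Submodule.finrank_eq_zero, hfib _ ht, Finset.card_eq_zero, ← Ne,
        ← Finset.nonempty_iff_ne_empty]
      exact ⟨j, Finset.mem_filter.2 ⟨hj, rfl⟩⟩
  rw [hZ]
  refine ⟨Finset.finite_toSet _, ?_⟩
  rw [finsum_mem_coe_finset, Finset.card_eq_sum_card_image τ J]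
  refine Finset.sum_congr rfl fun t ht => ?_
  obtain ⟨j, hj, rfl⟩ := Finset.mem_image.1 ht
  exact hfib _ (hτ j ((hmem j).1 hj))

end SymmetricFamilies

end SymmetricOperators

/-! ### The equation `f'' = -t² f` on a single interval. -/

section FundamentalSolutions

open Set

/-! ### The fundamental solutions of `f'' = -t² f` -/

/-- The solution of `f'' = -t² f` with `f 0 = 1` and `f' 0 = 0`. -/
noncomputable def cosSol (t x : ℝ) : ℝ := Real.cos (t * x)

/-- The solution of `f'' = -t² f` with `f 0 = 0` and `f' 0 = 1`. -/
noncomputable def sinSol (t x : ℝ) : ℝ := x * Real.sinc (t * x)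

/-- The use of `Real.sinc` makes `t = 0`, hence the eigenvalue zero, a regular parameter. -/
lemma sinSol_zero_left (x : ℝ) : sinSol 0 x = x := by simp [sinSol]

lemma sinSol_of_ne_zero {t : ℝ} (ht : t ≠ 0) (x : ℝ) : sinSol t x = Real.sin (t * x) / t := by
  rcases eq_or_ne x 0 with rfl | hx
  · simp [sinSol]
  · rw [sinSol, Real.sinc_of_ne_zero (mul_ne_zero ht hx)]
    field_simp

lemma mul_sinSol (t x : ℝ) : t * sinSol t x = Real.sin (t * x) := by
  rcases eq_or_ne t 0 with rfl | ht
  · simp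
  · rw [sinSol_of_ne_zero ht]; field_simp

lemma cosSol_zero_right (t : ℝ) : cosSol t 0 = 1 := by simp [cosSol]

lemma sinSol_zero_right (t : ℝ) : sinSol t 0 = 0 := by simp [sinSol]

lemma sinSol_pos {t x : ℝ} (ht : 0 ≤ t) (hx : 0 < x) (h : t * x < Real.pi) : 0 < sinSol t x := by
  rcases ht.eq_or_lt with rfl | ht
  · rwa [sinSol_zero_left]
  · rw [sinSol_of_ne_zero ht.ne']
    exact div_pos (Real.sin_pos_of_pos_of_lt_pi (by positivity) h) ht

lemma cosSol_add (t x y : ℝ) :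
    cosSol t (x + y) = cosSol t x * cosSol t y - t ^ 2 * sinSol t x * sinSol t y := by
  have : t ^ 2 * sinSol t x * sinSol t y = (t * sinSol t x) * (t * sinSol t y) := by ring
  rw [this, mul_sinSol, mul_sinSol, cosSol, mul_add, Real.cos_add, cosSol, cosSol]

lemma sinSol_add (t x y : ℝ) :
    sinSol t (x + y) = sinSol t x * cosSol t y + cosSol t x * sinSol t y := by
  rcases eq_or_ne t 0 with rfl | ht
  · simp [sinSol_zero_left, cosSol]
  · simp only [sinSol_of_ne_zero ht, cosSol, mul_add, Real.sin_add]
    field_simp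

lemma cosSol_sq_add (t x : ℝ) : cosSol t x ^ 2 + t ^ 2 * sinSol t x ^ 2 = 1 := by
  rw [← mul_pow, mul_sinSol, cosSol, Real.cos_sq_add_sin_sq]

lemma hasDerivAt_cosSol (t x : ℝ) : HasDerivAt (cosSol t) (-t ^ 2 * sinSol t x) x := by
  have h : HasDerivAt (cosSol t) (-Real.sin (t * x) * (t * 1)) x :=
    ((hasDerivAt_id x).const_mul t).cos
  refine h.congr_deriv ?_
  rw [← mul_sinSol]; ring

lemma hasDerivAt_sinSol (t x : ℝ) : HasDerivAt (sinSol t) (cosSol t x) x := by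
  rcases eq_or_ne t 0 with rfl | ht
  · have : sinSol 0 = id := funext sinSol_zero_left
    rw [this]
    simpa [cosSol] using hasDerivAt_id x
  · have : sinSol t = fun y => Real.sin (t * y) / t := funext (sinSol_of_ne_zero ht)
    rw [this]
    have h : HasDerivAt (fun y => Real.sin (t * y)) (Real.cos (t * x) * (t * 1)) x :=
      ((hasDerivAt_id x).const_mul t).sin
    refine (h.div_const t).congr_deriv ?_
    rw [cosSol]; field_simp

/-- Every solution of `g'' = -t² g` on an interval is a combination of the fundamental solutions. -/
lemma eq_fundamental_solutions {t l : ℝ} {g g' : ℝ → ℂ}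
    (hg : ∀ x ∈ Icc 0 l, HasDerivWithinAt g (g' x) (Icc 0 l) x)
    (hg' : ∀ x ∈ Icc 0 l, HasDerivWithinAt g' (-(t : ℂ) ^ 2 * g x) (Icc 0 l) x)
    {x : ℝ} (hx : x ∈ Icc 0 l) :
    g x = g 0 * cosSol t x + g' 0 * sinSol t x := by
  have hconst : ∀ w : ℝ → ℂ, (∀ y ∈ Icc 0 l, HasDerivWithinAt w 0 (Icc 0 l) y) → w x = w 0 := by
    intro w hw
    rcases eq_or_lt_of_le (hx.1.trans hx.2) with hl | hl
    · have : x = 0 := le_antisymm (hl ▸ hx.2) hx.1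
      rw [this]
    · exact constant_of_derivWithin_zero (fun y hy => (hw y hy).differentiableWithinAt)
        (fun y hy => (hw y (Ico_subset_Icc_self hy)).derivWithin
          (uniqueDiffOn_Icc hl y (Ico_subset_Icc_self hy))) x hx
  have hC : ∀ y, HasDerivWithinAt (fun y => (cosSol t y : ℂ))
      ((-t ^ 2 * sinSol t y : ℝ) : ℂ) (Icc 0 l) y :=
    fun y => (hasDerivAt_cosSol t y).ofReal_comp.hasDerivWithinAt
  have hS : ∀ y, HasDerivWithinAt (fun y => (sinSol t y : ℂ)) (cosSol t y : ℂ) (Icc 0 l) y :=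
    fun y => (hasDerivAt_sinSol t y).ofReal_comp.hasDerivWithinAt
  -- Undoing the flow on the pair `(g, g')` gives two constants of motion, whose values at `0` are
  -- `g' 0` and `g 0`.
  have h1 := hconst (fun y => g' y * cosSol t y + g y * ((t : ℂ) ^ 2 * sinSol t y)) fun y hy => by
    refine (((hg' y hy).mul (hC y)).add
      ((hg y hy).mul ((hS y).const_mul ((t : ℂ) ^ 2)))).congr_deriv ?_
    push_cast; ring
  have h2 := hconst (fun y => g y * cosSol t y - g' y * sinSol t y) fun y hy => by
    refine (((hg y hy).mul (hC y)).sub ((hg' y hy).mul (hS y))).congr_deriv ?_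
    push_cast; ring
  simp only [cosSol_zero_right, sinSol_zero_right, Complex.ofReal_one, Complex.ofReal_zero,
    mul_zero, mul_one, add_zero, sub_zero] at h1 h2
  have hsq : (cosSol t x : ℂ) ^ 2 + (t : ℂ) ^ 2 * (sinSol t x : ℂ) ^ 2 = 1 := by
    exact_mod_cast cosSol_sq_add t x
  rw [← h1, ← h2]
  linear_combination (-g x) * hsq

/-- For `lam < 0` the function `re (conj g * g')` of a solution of `g'' = -lam g` is increasing, and
it has equal values at both ends only if `g` vanishes. -/
lemma re_conj_mul_deriv_le {lam l : ℝ} (hlam : lam < 0) (hl : 0 < l) {g g' : ℝ → ℂ}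
    (hg : ∀ x ∈ Icc 0 l, HasDerivWithinAt g (g' x) (Icc 0 l) x)
    (hg' : ∀ x ∈ Icc 0 l, HasDerivWithinAt g' (-(lam : ℂ) * g x) (Icc 0 l) x) :
    (starRingEnd ℂ (g 0) * g' 0).re ≤ (starRingEnd ℂ (g l) * g' l).re ∧
    ((starRingEnd ℂ (g 0) * g' 0).re = (starRingEnd ℂ (g l) * g' l).re →
      ∀ x ∈ Icc 0 l, g x = 0) := by
  set h : ℝ → ℝ := fun x => (starRingEnd ℂ (g x) * g' x).re
  have hd : ∀ x ∈ Icc 0 l,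
      HasDerivWithinAt h (‖g' x‖ ^ 2 - lam * ‖g x‖ ^ 2) (Icc 0 l) x := by
    intro x hx
    have hs : HasDerivWithinAt (fun x => starRingEnd ℂ (g x)) (starRingEnd ℂ (g' x)) (Icc 0 l) x :=
      (hg x hx).star
    have hm := hs.mul (hg' x hx)
    have hr := Complex.reCLM.hasFDerivAt.comp_hasDerivWithinAt x hm
    refine hr.congr_deriv ?_
    rw [← Complex.normSq_eq_norm_sq, ← Complex.normSq_eq_norm_sq]
    simp [Complex.normSq_apply]
    ring
  have hmono : MonotoneOn h (Icc 0 l) := by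
    refine monotoneOn_of_hasDerivWithinAt_nonneg (convex_Icc 0 l)
      (f' := fun x => ‖g' x‖ ^ 2 - lam * ‖g x‖ ^ 2)
      (fun x hx => (hd x hx).continuousWithinAt)
      (fun x hx => (hd x (interior_subset hx)).mono interior_subset) fun x _ => ?_
    nlinarith [sq_nonneg ‖g' x‖, sq_nonneg ‖g x‖]
  have h0 : (0 : ℝ) ∈ Icc 0 l := ⟨le_rfl, hl.le⟩
  have hl' : l ∈ Icc 0 l := ⟨hl.le, le_rfl⟩
  refine ⟨hmono h0 hl' hl.le, fun heq x hx => ?_⟩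
  have hconst : ∀ y ∈ Icc 0 l, h y = h 0 := fun y hy =>
    le_antisymm ((hmono hy hl' hy.2).trans_eq heq.symm) (hmono h0 hy hy.1)
  have hz : HasDerivWithinAt h 0 (Icc 0 l) x :=
    (hasDerivWithinAt_const x (Icc 0 l) (h 0)).congr hconst (hconst x hx)
  -- A monotone function with equal end values is constant, so its derivative, a sum of two
  -- nonnegative terms, vanishes.
  have := (uniqueDiffOn_Icc hl x hx).eq_deriv _ (hd x hx) hz
  have h1 : ‖g x‖ ^ 2 = 0 := by nlinarith [sq_nonneg ‖g' x‖, sq_nonneg ‖g x‖]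
  simpa using h1

/-! ### The energy of a solution on a short interval -/

/-- For `f = a` at `0` and `f = b` at `l`, where `f'' = -t² f` on `[0, l]`, one has
`f' 0 = endCoeff t l * b - diagCoeff t l * a`. -/
noncomputable def diagCoeff (t l : ℝ) : ℝ := cosSol t l / sinSol t l

/-- See `diagCoeff`. -/
noncomputable def endCoeff (t l : ℝ) : ℝ := 1 / sinSol t l

/-- This is `x cot (x/2)`, continued to `0`; the sign of its derivative is that of `sin x - x`. It
governs the part of the piece energy that is odd under reflection. -/
lemma strictAntiOn_one_add_cos_div_sinc :
    StrictAntiOn (fun x => (1 + Real.cos x) / Real.sinc x) (Ico 0 Real.pi) := by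
  have hpos : ∀ x ∈ Ico 0 Real.pi, 0 < Real.sinc x := by
    intro x hx
    have := sinSol_pos hx.1 one_pos (by simpa using hx.2)
    simpa [sinSol] using this
  refine strictAntiOn_of_deriv_neg (convex_Ico _ _) ?_ ?_
  · exact (by fun_prop : Continuous fun x => 1 + Real.cos x).continuousOn.div
      Real.continuous_sinc.continuousOn fun x hx => (hpos x hx).ne'
  · intro x hx
    rw [interior_Ico] at hx
    have hs := Real.sin_pos_of_mem_Ioo hx
    have heq : (fun x => (1 + Real.cos x) / Real.sinc x) =ᶠ[nhds x]
        fun x => x * (1 + Real.cos x) / Real.sin x := by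
      filter_upwards [lt_mem_nhds hx.1] with y hy
      rw [Real.sinc_of_ne_zero hy.ne', div_div_eq_mul_div]; ring
    have hd : HasDerivAt (fun x => x * (1 + Real.cos x) / Real.sin x)
        (((1 * (1 + Real.cos x) + x * (-Real.sin x)) * Real.sin x
          - x * (1 + Real.cos x) * Real.cos x) / Real.sin x ^ 2) x :=
      ((hasDerivAt_id x).mul ((Real.hasDerivAt_cos x).const_add 1)).div
        (Real.hasDerivAt_sin x) hs.ne'
    rw [heq.deriv_eq, hd.deriv]
    refine div_neg_of_neg_of_pos ?_ (by positivity)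
    have h1 : (1 * (1 + Real.cos x) + x * (-Real.sin x)) * Real.sin x
        - x * (1 + Real.cos x) * Real.cos x = (1 + Real.cos x) * (Real.sin x - x) := by
      linear_combination (-x) * Real.sin_sq_add_cos_sq x
    rw [h1]
    refine mul_neg_of_pos_of_neg ?_ (by linarith [Real.sin_lt hx.1])
    nlinarith [Real.sin_sq_add_cos_sq x, Real.neg_one_le_cos x]

/-- This is `x tan (x/2)`; the sign of its derivative is that of `sin x + x`. It governs the even
part of the piece energy. -/
lemma strictMonoOn_one_sub_cos_div_sinc :
    StrictMonoOn (fun x => (1 - Real.cos x) / Real.sinc x) (Ico 0 Real.pi) := by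
  have hpos : ∀ x ∈ Ico 0 Real.pi, 0 < Real.sinc x := by
    intro x hx
    have := sinSol_pos hx.1 one_pos (by simpa using hx.2)
    simpa [sinSol] using this
  refine strictMonoOn_of_deriv_pos (convex_Ico _ _) ?_ ?_
  · exact (by fun_prop : Continuous fun x => 1 - Real.cos x).continuousOn.div
      Real.continuous_sinc.continuousOn fun x hx => (hpos x hx).ne'
  · intro x hx
    rw [interior_Ico] at hx
    have hs := Real.sin_pos_of_mem_Ioo hx
    have heq : (fun x => (1 - Real.cos x) / Real.sinc x) =ᶠ[nhds x]
        fun x => x * (1 - Real.cos x) / Real.sin x := by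
      filter_upwards [lt_mem_nhds hx.1] with y hy
      rw [Real.sinc_of_ne_zero hy.ne', div_div_eq_mul_div]; ring
    have hd : HasDerivAt (fun x => x * (1 - Real.cos x) / Real.sin x)
        (((1 * (1 - Real.cos x) + x * (- -Real.sin x)) * Real.sin x
          - x * (1 - Real.cos x) * Real.cos x) / Real.sin x ^ 2) x :=
      ((hasDerivAt_id x).mul ((Real.hasDerivAt_cos x).const_sub 1)).div
        (Real.hasDerivAt_sin x) hs.ne'
    rw [heq.deriv_eq, hd.deriv]
    refine div_pos ?_ (by positivity)
    have h1 : (1 * (1 - Real.cos x) + x * (- -Real.sin x)) * Real.sin x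
        - x * (1 - Real.cos x) * Real.cos x = (1 - Real.cos x) * (Real.sin x + x) := by
      linear_combination x * Real.sin_sq_add_cos_sq x
    rw [h1]
    refine mul_pos ?_ (by linarith [hx.1])
    nlinarith [Real.sin_sq_add_cos_sq x, Real.cos_le_one x]

/-- The energy `∫ |f'|² - t² |f|²` on `[0, l]` of the solution of `f'' = -t² f` with boundary
values `a` and `b`. -/
noncomputable def pieceForm (t l : ℝ) (a b : ℂ) : ℝ :=
  diagCoeff t l * (‖a‖ ^ 2 + ‖b‖ ^ 2) - 2 * endCoeff t l * (starRingEnd ℂ a * b).re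

/-- Reflection of the piece diagonalises the form, reducing its monotonicity in `t` to two scalar
functions. -/
lemma pieceForm_eq (t l : ℝ) (a b : ℂ) :
    pieceForm t l a b = ((diagCoeff t l + endCoeff t l) * ‖a - b‖ ^ 2
      + (diagCoeff t l - endCoeff t l) * ‖a + b‖ ^ 2) / 2 := by
  simp only [pieceForm, ← Complex.normSq_eq_norm_sq, Complex.normSq_apply, Complex.mul_re,
    Complex.add_re, Complex.add_im, Complex.sub_re, Complex.sub_im, Complex.conj_re,
    Complex.conj_im]
  ring

lemma diagCoeff_add_endCoeff (t l : ℝ) :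
    diagCoeff t l + endCoeff t l = l⁻¹ * ((1 + Real.cos (t * l)) / Real.sinc (t * l)) := by
  simp only [diagCoeff, endCoeff, cosSol, sinSol, div_eq_mul_inv, mul_inv]
  ring

lemma diagCoeff_sub_endCoeff (t l : ℝ) :
    diagCoeff t l - endCoeff t l = -(l⁻¹ * ((1 - Real.cos (t * l)) / Real.sinc (t * l))) := by
  simp only [diagCoeff, endCoeff, cosSol, sinSol, div_eq_mul_inv, mul_inv]
  ring

lemma pieceForm_le {s t l : ℝ} (hs : 0 ≤ s) (hst : s < t) (hl : 0 < l) (ht : t * l < Real.pi)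
    (a b : ℂ) : pieceForm t l a b ≤ pieceForm s l a b ∧
      (a ≠ 0 ∨ b ≠ 0 → pieceForm t l a b < pieceForm s l a b) := by
  have hs' : s * l ∈ Ico 0 Real.pi := ⟨by positivity, by nlinarith⟩
  have ht' : t * l ∈ Ico 0 Real.pi := ⟨by nlinarith, ht⟩
  have hlt : s * l < t * l := by gcongr
  have h1 : diagCoeff t l + endCoeff t l < diagCoeff s l + endCoeff s l := by
    rw [diagCoeff_add_endCoeff, diagCoeff_add_endCoeff]
    exact mul_lt_mul_of_pos_left (strictAntiOn_one_add_cos_div_sinc hs' ht' hlt) (by positivity)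
  have h2 : diagCoeff t l - endCoeff t l < diagCoeff s l - endCoeff s l := by
    rw [diagCoeff_sub_endCoeff, diagCoeff_sub_endCoeff, neg_lt_neg_iff]
    exact mul_lt_mul_of_pos_left (strictMonoOn_one_sub_cos_div_sinc hs' ht' hlt) (by positivity)
  rw [pieceForm_eq, pieceForm_eq]
  constructor
  · gcongr
  · intro hab
    have : 0 < ‖a - b‖ ^ 2 ∨ 0 < ‖a + b‖ ^ 2 := by
      by_contra! hcon
      have e1 : a - b = 0 := by simpa using le_antisymm hcon.1 (sq_nonneg _)
      have e2 : a + b = 0 := by simpa using le_antisymm hcon.2 (sq_nonneg _)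
      have ea : a = 0 := by linear_combination (e1 + e2) / 2
      have eb : b = 0 := by linear_combination (e2 - e1) / 2
      tauto
    rcases this with h | h
    · nlinarith [sq_nonneg ‖a + b‖]
    · nlinarith [sq_nonneg ‖a - b‖]

lemma pieceForm_zero_nonneg {l : ℝ} (hl : 0 < l) (a b : ℂ) : 0 ≤ pieceForm 0 l a b := by
  rw [pieceForm_eq]
  have h1 : diagCoeff 0 l - endCoeff 0 l = 0 := by simp [diagCoeff, endCoeff, cosSol]
  have h2 : 0 ≤ diagCoeff 0 l + endCoeff 0 l := by
    simp only [diagCoeff, endCoeff, cosSol, sinSol_zero_left, zero_mul, Real.cos_zero]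
    positivity
  rw [h1]
  positivity

/-- A vanishing end value removes the cross term, leaving a diagonal coefficient with the sign of
`cos (t l)`. -/
lemma pieceForm_nonpos {t l : ℝ} (ht : 0 ≤ t) (hl : 0 < l) (h1 : Real.pi / 2 ≤ t * l)
    (h2 : t * l < Real.pi) {a b : ℂ} (hab : a = 0 ∨ b = 0) : pieceForm t l a b ≤ 0 := by
  have h0 : (starRingEnd ℂ a * b).re = 0 := by rcases hab with rfl | rfl <;> simp
  rw [pieceForm, h0, mul_zero, sub_zero]
  refine mul_nonpos_of_nonpos_of_nonneg ?_ (by positivity)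
  exact div_nonpos_of_nonpos_of_nonneg
    (Real.cos_nonpos_of_pi_div_two_le_of_le h1 (by linarith [Real.pi_pos])) (sinSol_pos ht hl h2).le

lemma continuousOn_sinSol_inv {k l : ℝ} (hl : 0 < l) (h : k * l < Real.pi) :
    ContinuousOn (fun t => (sinSol t l)⁻¹) (Icc 0 k) := by
  refine ContinuousOn.inv₀ ?_ fun t ht => (sinSol_pos ht.1 hl ?_).ne'
  · unfold sinSol
    exact (continuous_const.mul (Real.continuous_sinc.comp (by fun_prop))).continuousOn
  · nlinarith [ht.2]

lemma continuousOn_endCoeff {k l : ℝ} (hl : 0 < l) (h : k * l < Real.pi) :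
    ContinuousOn (fun t => endCoeff t l) (Icc 0 k) := by
  simpa only [endCoeff, one_div] using continuousOn_sinSol_inv hl h

lemma continuousOn_diagCoeff {k l : ℝ} (hl : 0 < l) (h : k * l < Real.pi) :
    ContinuousOn (fun t => diagCoeff t l) (Icc 0 k) := by
  simp only [diagCoeff, div_eq_mul_inv]
  refine ContinuousOn.mul ?_ (continuousOn_sinSol_inv hl h)
  unfold cosSol
  fun_prop

end FundamentalSolutions

/-! ### The node space of a subdivided graph and its Hermitian form. -/

section Subdivision

open Set Module
open scoped InnerProductSpace Classical

namespace QuantumGraph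

variable {V E : Type*} (Γ : QuantumGraph V E) (p : E → ℕ)

/-! ### Subdivided graphs -/

/-- The vertices that carry a degree of freedom: Neumann vertices which are not isolated. -/
abbrev ActiveVertex : Type _ :=
  {v : V // Γ.cond v = .neumann ∧ ∃ h : E × Bool, Γ.endVertex h = v}

/-- The nodes of the graph whose edge `e` is divided into `p e` pieces of equal length. -/
abbrev Node : Type _ := Γ.ActiveVertex ⊕ (Σ e : E, Fin (p e - 1))

/-- The node at a vertex, if it carries a degree of freedom. -/
noncomputable def vertexNode (v : V) : Option (Γ.Node p) :=
  if h : Γ.cond v = .neumann ∧ ∃ h : E × Bool, Γ.endVertex h = v then some (.inl ⟨v, h⟩) else none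

/-- The `i`-th division point of the edge `e`, for `0 ≤ i ≤ p e`. -/
noncomputable def node (e : E) (i : ℕ) : Option (Γ.Node p) :=
  if i = 0 then Γ.vertexNode p (Γ.src e)
  else if h : i - 1 < p e - 1 then some (.inr ⟨e, ⟨i - 1, h⟩⟩)
  else Γ.vertexNode p (Γ.tgt e)

/-- The length of the pieces of the edge `e`. -/
noncomputable def pieceLength (e : E) : ℝ := Γ.length e / p e

variable {p}

lemma pieceLength_pos {e : E} (hp : 0 < p e) : 0 < Γ.pieceLength p e :=
  div_pos (Γ.length_pos e) (by exact_mod_cast hp)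

lemma mul_pieceLength {e : E} (hp : 0 < p e) : p e * Γ.pieceLength p e = Γ.length e := by
  have : (p e : ℝ) ≠ 0 := by positivity
  rw [pieceLength]; field_simp

lemma vertexNode_ne_inr (v : V) (w : Σ e : E, Fin (p e - 1)) :
    Γ.vertexNode p v ≠ some (.inr w) := by
  unfold vertexNode
  split_ifs <;> simp

lemma vertexNode_eq_inl_iff (v : V) (w : Γ.ActiveVertex) :
    Γ.vertexNode p v = some (.inl w) ↔ v = w := by
  unfold vertexNode
  split_ifs with h
  · simp [Subtype.ext_iff]
  · simp only [false_iff]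
    rintro rfl
    exact h w.2

lemma node_zero (e : E) : Γ.node p e 0 = Γ.vertexNode p (Γ.src e) := by simp [node]

lemma node_last {e : E} (hp : 0 < p e) : Γ.node p e (p e) = Γ.vertexNode p (Γ.tgt e) := by
  simp [node, hp.ne']

lemma node_succ {e : E} (j : Fin (p e - 1)) : Γ.node p e (j + 1) = some (.inr ⟨e, j⟩) := by
  simp [node]

lemma node_eq_inr_iff (e e₀ : E) (i : ℕ) (j : Fin (p e₀ - 1)) :
    Γ.node p e i = some (.inr ⟨e₀, j⟩) ↔ e = e₀ ∧ i = j + 1 := by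
  constructor
  · intro h
    unfold node at h
    split_ifs at h with h1 h2
    · exact absurd h (Γ.vertexNode_ne_inr _ _)
    · simp only [Option.some.injEq, Sum.inr.injEq] at h
      cases h
      exact ⟨rfl, by simp; omega⟩
    · exact absurd h (Γ.vertexNode_ne_inr _ _)
  · rintro ⟨rfl, rfl⟩
    exact Γ.node_succ j

/-- The bound on `i` restricts to left ends of pieces; right ends are treated separately, so the two
ends of a loop are not confused. -/
lemma node_eq_inl_iff {e : E} {i : ℕ} (hi : i < p e) (v : Γ.ActiveVertex) :
    Γ.node p e i = some (.inl v) ↔ i = 0 ∧ Γ.src e = v := by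
  unfold node
  split_ifs with h1 h2
  · simp [h1, vertexNode_eq_inl_iff]
  · simp [h1]
  · omega

lemma node_succ_eq_inl_iff {e : E} {i : ℕ} (hi : i < p e) (v : Γ.ActiveVertex) :
    Γ.node p e (i + 1) = some (.inl v) ↔ i = p e - 1 ∧ Γ.tgt e = v := by
  unfold node
  rw [if_neg (Nat.succ_ne_zero i), Nat.add_sub_cancel]
  split_ifs with h2
  · simp [h2.ne]
  · have : i = p e - 1 := by omega
    simp [this, vertexNode_eq_inl_iff]

/-- Every node is a division point of some edge. -/
lemma exists_node_eq (hp : ∀ e, 0 < p e) (w : Γ.Node p) :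
    ∃ e, ∃ i < p e, Γ.node p e i = some w ∨ Γ.node p e (i + 1) = some w := by
  rcases w with ⟨v, hv, ⟨e, b⟩, h⟩ | ⟨e, j⟩
  · cases b
    · exact ⟨e, 0, hp e, .inl ((Γ.node_eq_inl_iff (hp e) _).2 ⟨rfl, by simpa [endVertex] using h⟩)⟩
    · refine ⟨e, p e - 1, by have := hp e; omega, .inr ?_⟩
      exact (Γ.node_succ_eq_inl_iff (by have := hp e; omega) _).2
        ⟨rfl, by simpa [endVertex] using h⟩
  · exact ⟨e, j, by omega, .inr (Γ.node_succ j)⟩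

variable (p) in
/-- Functions on the nodes. -/
abbrev NodeSpace : Type _ := EuclideanSpace ℂ (Γ.Node p)

variable (p) in
/-- The vector representing evaluation at the `i`-th division point of `e`. -/
noncomputable def nodeVec (e : E) (i : ℕ) : Γ.NodeSpace p :=
  (Γ.node p e i).elim 0 fun w => EuclideanSpace.single w 1

/-- The value at the `i`-th division point of `e`. -/
noncomputable def nodeVal (x : Γ.NodeSpace p) (e : E) (i : ℕ) : ℂ :=
  (Γ.node p e i).elim 0 fun w => x w

lemma nodeVec_apply (e : E) (i : ℕ) (w : Γ.Node p) :
    Γ.nodeVec p e i w = if Γ.node p e i = some w then 1 else 0 := by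
  unfold nodeVec
  cases h : Γ.node p e i with
  | none => simp
  | some w' => simp [PiLp.single_apply, eq_comm]

variable [Fintype V] [Fintype E]

lemma inner_nodeVec (x : Γ.NodeSpace p) (e : E) (i : ℕ) :
    ⟪Γ.nodeVec p e i, x⟫_ℂ = Γ.nodeVal x e i := by
  unfold nodeVec nodeVal
  cases Γ.node p e i <;> simp [EuclideanSpace.inner_single_left]

lemma inner_nodeVec_right (x : Γ.NodeSpace p) (e : E) (i : ℕ) :
    ⟪x, Γ.nodeVec p e i⟫_ℂ = starRingEnd ℂ (Γ.nodeVal x e i) := by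
  rw [← inner_nodeVec, inner_conj_symm]

lemma nodeVal_add (x y : Γ.NodeSpace p) (e : E) (i : ℕ) :
    Γ.nodeVal (x + y) e i = Γ.nodeVal x e i + Γ.nodeVal y e i := by
  simp only [← inner_nodeVec, inner_add_right]

lemma nodeVal_smul (c : ℂ) (x : Γ.NodeSpace p) (e : E) (i : ℕ) :
    Γ.nodeVal (c • x) e i = c * Γ.nodeVal x e i := by
  simp only [← inner_nodeVec, inner_smul_right]

variable (p) in
/-- The operator on the node space whose quadratic form is the sum of the energies, at the spectral
parameter `t²`, of the solutions with given node values on all the pieces. -/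
noncomputable def nodeOp (t : ℝ) : Γ.NodeSpace p →ₗ[ℂ] Γ.NodeSpace p where
  toFun x := ∑ e, ∑ i ∈ Finset.range (p e),
    ((diagCoeff t (Γ.pieceLength p e) * Γ.nodeVal x e i
        - endCoeff t (Γ.pieceLength p e) * Γ.nodeVal x e (i + 1)) • Γ.nodeVec p e i
      + (diagCoeff t (Γ.pieceLength p e) * Γ.nodeVal x e (i + 1)
        - endCoeff t (Γ.pieceLength p e) * Γ.nodeVal x e i) • Γ.nodeVec p e (i + 1))
  map_add' x y := by
    simp only [← Finset.sum_add_distrib]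
    refine Finset.sum_congr rfl fun e _ => Finset.sum_congr rfl fun i _ => ?_
    simp only [nodeVal_add]
    module
  map_smul' c x := by
    simp only [Finset.smul_sum, RingHom.id_apply]
    refine Finset.sum_congr rfl fun e _ => Finset.sum_congr rfl fun i _ => ?_
    simp only [nodeVal_smul]
    module

lemma nodeOp_apply (t : ℝ) (x : Γ.NodeSpace p) :
    Γ.nodeOp p t x = ∑ e, ∑ i ∈ Finset.range (p e),
    ((diagCoeff t (Γ.pieceLength p e) * Γ.nodeVal x e i
        - endCoeff t (Γ.pieceLength p e) * Γ.nodeVal x e (i + 1)) • Γ.nodeVec p e i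
      + (diagCoeff t (Γ.pieceLength p e) * Γ.nodeVal x e (i + 1)
        - endCoeff t (Γ.pieceLength p e) * Γ.nodeVal x e i) • Γ.nodeVec p e (i + 1)) := rfl

variable (p) in
lemma nodeOp_isSymmetric (t : ℝ) : (Γ.nodeOp p t).IsSymmetric := by
  intro x y
  simp only [nodeOp_apply, sum_inner, inner_sum, inner_add_left, inner_add_right, inner_smul_left,
    inner_smul_right, inner_nodeVec, inner_nodeVec_right, map_sub, map_mul, Complex.conj_ofReal]
  refine Finset.sum_congr rfl fun e _ => Finset.sum_congr rfl fun i _ => ?_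
  ring

lemma re_inner_nodeOp (t : ℝ) (x : Γ.NodeSpace p) :
    (⟪x, Γ.nodeOp p t x⟫_ℂ).re = ∑ e, ∑ i ∈ Finset.range (p e),
      pieceForm t (Γ.pieceLength p e) (Γ.nodeVal x e i) (Γ.nodeVal x e (i + 1)) := by
  simp only [nodeOp_apply, inner_sum, inner_add_right, inner_smul_right, inner_nodeVec_right,
    Complex.re_sum]
  refine Finset.sum_congr rfl fun e _ => Finset.sum_congr rfl fun i _ => ?_
  simp only [pieceForm, ← Complex.normSq_eq_norm_sq, Complex.normSq_apply, Complex.mul_re,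
    Complex.mul_im, Complex.add_re, Complex.sub_re, Complex.sub_im, Complex.conj_re,
    Complex.conj_im, Complex.ofReal_re, Complex.ofReal_im]
  ring

lemma continuousOn_nodeOp (hp : ∀ e, 0 < p e) {k : ℝ}
    (hk : ∀ e, k * Γ.pieceLength p e < Real.pi) (x : Γ.NodeSpace p) :
    ContinuousOn (fun t => Γ.nodeOp p t x) (Icc 0 k) := by
  simp only [nodeOp_apply]
  refine continuousOn_finsetSum _ fun e _ => continuousOn_finsetSum _ fun i _ => ?_
  have h1 : ContinuousOn (fun t => (diagCoeff t (Γ.pieceLength p e) : ℂ)) (Icc 0 k) :=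
    Complex.continuous_ofReal.comp_continuousOn
      (continuousOn_diagCoeff (Γ.pieceLength_pos (hp e)) (hk e))
  have h2 : ContinuousOn (fun t => (endCoeff t (Γ.pieceLength p e) : ℂ)) (Icc 0 k) :=
    Complex.continuous_ofReal.comp_continuousOn
      (continuousOn_endCoeff (Γ.pieceLength_pos (hp e)) (hk e))
  exact (((h1.mul continuousOn_const).sub (h2.mul continuousOn_const)).smul
    continuousOn_const).add (((h1.mul continuousOn_const).sub (h2.mul continuousOn_const)).smul
    continuousOn_const)

/-- A nonzero coordinate is an end value of some piece, whose energy drops strictly. This is where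
isolated vertices have to be excluded from the nodes. -/
lemma re_inner_nodeOp_lt (hp : ∀ e, 0 < p e) {s t : ℝ} (hs : 0 ≤ s) (hst : s < t)
    (ht : ∀ e, t * Γ.pieceLength p e < Real.pi) {x : Γ.NodeSpace p} (hx : x ≠ 0) :
    (⟪x, Γ.nodeOp p t x⟫_ℂ).re < (⟪x, Γ.nodeOp p s x⟫_ℂ).re := by
  rw [re_inner_nodeOp, re_inner_nodeOp]
  have hle := fun e i => pieceForm_le hs hst (Γ.pieceLength_pos (hp e)) (ht e)
    (Γ.nodeVal x e i) (Γ.nodeVal x e (i + 1))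
  obtain ⟨w, hw⟩ : ∃ w, x w ≠ 0 := by
    by_contra! h
    exact hx (by ext w; exact h w)
  obtain ⟨e, i, hi, h⟩ := Γ.exists_node_eq hp w
  refine Finset.sum_lt_sum (fun e _ => Finset.sum_le_sum fun i _ => (hle e i).1)
    ⟨e, Finset.mem_univ e, Finset.sum_lt_sum (fun i _ => (hle e i).1)
      ⟨i, Finset.mem_range.2 hi, (hle e i).2 ?_⟩⟩
  rcases h with h | h
  · left; simpa [nodeVal, h] using hw
  · right; simpa [nodeVal, h] using hw

lemma re_inner_nodeOp_zero_nonneg (hp : ∀ e, 0 < p e) (x : Γ.NodeSpace p) :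
    0 ≤ (⟪x, Γ.nodeOp p 0 x⟫_ℂ).re := by
  rw [re_inner_nodeOp]
  exact Finset.sum_nonneg fun e _ => Finset.sum_nonneg fun i _ =>
    pieceForm_zero_nonneg (Γ.pieceLength_pos (hp e)) _ _

lemma nodeOp_apply_apply (t : ℝ) (x : Γ.NodeSpace p) (w : Γ.Node p) :
    Γ.nodeOp p t x w = ∑ e, ∑ i ∈ Finset.range (p e),
      ((if Γ.node p e i = some w then diagCoeff t (Γ.pieceLength p e) * Γ.nodeVal x e i
        - endCoeff t (Γ.pieceLength p e) * Γ.nodeVal x e (i + 1) else 0)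
      + (if Γ.node p e (i + 1) = some w then
        diagCoeff t (Γ.pieceLength p e) * Γ.nodeVal x e (i + 1)
        - endCoeff t (Γ.pieceLength p e) * Γ.nodeVal x e i else 0)) := by
  simp only [nodeOp_apply, WithLp.ofLp_sum, Finset.sum_apply, PiLp.add_apply, PiLp.smul_apply,
    nodeVec_apply, smul_eq_mul, mul_ite, mul_one, mul_zero]

/-- Exactly two pieces meet at an interior node. Up to the factor `sinSol`, this row is the
three-term recurrence satisfied by equally spaced samples of a wave. -/
lemma nodeOp_apply_inr (t : ℝ) (x : Γ.NodeSpace p) (e : E) (j : Fin (p e - 1)) :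
    Γ.nodeOp p t x (.inr ⟨e, j⟩) =
      2 * diagCoeff t (Γ.pieceLength p e) * Γ.nodeVal x e (j + 1)
      - endCoeff t (Γ.pieceLength p e) * (Γ.nodeVal x e j + Γ.nodeVal x e (j + 2)) := by
  rw [nodeOp_apply_apply, Finset.sum_eq_single e]
  · simp only [node_eq_inr_iff, true_and, add_left_inj, Finset.sum_add_distrib]
    rw [Finset.sum_ite_eq', Finset.sum_ite_eq', if_pos (by simp; omega), if_pos (by simp; omega)]
    ring
  · intro e' _ he'
    simp [node_eq_inr_iff, he']
  · simp

lemma nodeOp_apply_inl (hp : ∀ e, 0 < p e) (t : ℝ) (x : Γ.NodeSpace p) (v : Γ.ActiveVertex) :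
    Γ.nodeOp p t x (.inl v) = ∑ e,
      ((if Γ.src e = v then diagCoeff t (Γ.pieceLength p e) * Γ.nodeVal x e 0
        - endCoeff t (Γ.pieceLength p e) * Γ.nodeVal x e 1 else 0)
      + (if Γ.tgt e = v then diagCoeff t (Γ.pieceLength p e) * Γ.nodeVal x e (p e)
        - endCoeff t (Γ.pieceLength p e) * Γ.nodeVal x e (p e - 1) else 0)) := by
  rw [nodeOp_apply_apply]
  refine Finset.sum_congr rfl fun e _ => ?_
  rw [Finset.sum_add_distrib]
  have hpe := hp e
  congr 1
  · rw [Finset.sum_eq_single 0]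
    · simp [Γ.node_eq_inl_iff hpe]
    · intro i hi hi0
      rw [if_neg]
      rw [Γ.node_eq_inl_iff (Finset.mem_range.1 hi)]
      tauto
    · intro h; simp at h; omega
  · rw [Finset.sum_eq_single (p e - 1)]
    · simp [Nat.sub_add_cancel hpe, Γ.node_last hpe, vertexNode_eq_inl_iff]
    · intro i hi hi0
      rw [if_neg]
      rw [Γ.node_succ_eq_inl_iff (Finset.mem_range.1 hi)]
      tauto
    · intro h; simp at h; omega

end QuantumGraph

end Subdivision

/-! ### Eigenfunctions as the kernel of the node operator, and absence of negative eigenvalues. -/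

section Eigenfunctions

open Set Module
open scoped InnerProductSpace Classical

/-- The solution of `f'' = -t² f` with `f 0 = a` and `f' 0 = b`. -/
noncomputable def waveSol (t : ℝ) (a b : ℂ) (x : ℝ) : ℂ := a * cosSol t x + b * sinSol t x

lemma waveSol_zero (t : ℝ) (a b : ℂ) : waveSol t a b 0 = a := by
  simp [waveSol, cosSol_zero_right, sinSol_zero_right]

lemma hasDerivAt_waveSol (t : ℝ) (a b : ℂ) (x : ℝ) :
    HasDerivAt (waveSol t a b) (waveSol t b (-(t : ℂ) ^ 2 * a) x) x := by
  refine (((hasDerivAt_cosSol t x).ofReal_comp.const_mul a).add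
    ((hasDerivAt_sinSol t x).ofReal_comp.const_mul b)).congr_deriv ?_
  simp only [waveSol]
  push_cast
  ring

/-- The addition theorems for sine and cosine; this recurrence makes interior rows of `nodeOp`
vanish on sampled waves. -/
lemma waveSol_add_waveSol (t : ℝ) (a b : ℂ) (x l : ℝ) :
    waveSol t a b x + waveSol t a b (x + l + l) =
      2 * cosSol t l * waveSol t a b (x + l) := by
  have h : (cosSol t l : ℂ) ^ 2 + (t : ℂ) ^ 2 * (sinSol t l : ℂ) ^ 2 = 1 := by
    exact_mod_cast cosSol_sq_add t l
  simp only [waveSol, cosSol_add t (x + l) l, cosSol_add t x l, sinSol_add t (x + l) l,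
    sinSol_add t x l]
  push_cast
  linear_combination (-(a * cosSol t x + b * sinSol t x)) * h

lemma waveSol_deriv_right {t l : ℝ} (hl : sinSol t l ≠ 0) (a b : ℂ) (x : ℝ) :
    waveSol t b (-(t : ℂ) ^ 2 * a) (x + l) =
      diagCoeff t l * waveSol t a b (x + l) - endCoeff t l * waveSol t a b x := by
  have h : (cosSol t l : ℂ) ^ 2 + (t : ℂ) ^ 2 * (sinSol t l : ℂ) ^ 2 = 1 := by
    exact_mod_cast cosSol_sq_add t l
  have hl' : (sinSol t l : ℂ) ≠ 0 := by exact_mod_cast hl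
  simp only [waveSol, diagCoeff, endCoeff, cosSol_add t x l, sinSol_add t x l]
  push_cast
  field_simp
  linear_combination (-(a * cosSol t x + b * sinSol t x)) * h

lemma waveSol_deriv_left {t l : ℝ} (hl : sinSol t l ≠ 0) (a b : ℂ) :
    b = endCoeff t l * waveSol t a b l - diagCoeff t l * a := by
  have hl' : (sinSol t l : ℂ) ≠ 0 := by exact_mod_cast hl
  simp only [waveSol, diagCoeff, endCoeff]
  push_cast
  field_simp
  ring

namespace QuantumGraph

variable {V E : Type*} (Γ : QuantumGraph V E) {p : E → ℕ}

/-! ### Functions on the graph that solve the eigenvalue equation on the edges -/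

/-- The function on the graph which solves `f'' = -t² f` on every edge, with `f = a e` and
`f' = b e` at the beginning of the edge `e`. -/
noncomputable def wave (t : ℝ) (a b : E → ℂ) : Γ.Fn := fun e x => waveSol t (a e) (b e) x

variable {Γ}

lemma onEdge_of_mem (f : Γ.Fn) (e : E) {x : ℝ} (hx : x ∈ Icc 0 (Γ.length e)) :
    Γ.onEdge f e x = f e ⟨x, hx⟩ := IccExtend_of_mem _ _ hx

lemma hasDerivWithinAt_onEdge {f : Γ.Fn} (hf : Γ.Diff f) (e : E) {x : ℝ}
    (hx : x ∈ Icc 0 (Γ.length e)) :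
    HasDerivWithinAt (Γ.onEdge f e) (Γ.onEdge (Γ.D f) e x) (Icc 0 (Γ.length e)) x := by
  rw [onEdge_of_mem _ _ hx]
  exact (hf e x hx).hasDerivWithinAt

lemma hasDerivWithinAt_onEdge_wave (t : ℝ) (a b : E → ℂ) (e : E) {x : ℝ}
    (hx : x ∈ Icc 0 (Γ.length e)) :
    HasDerivWithinAt (Γ.onEdge (Γ.wave t a b) e) (waveSol t (b e) (-(t : ℂ) ^ 2 * a e) x)
      (Icc 0 (Γ.length e)) x :=
  (hasDerivAt_waveSol t (a e) (b e) x).hasDerivWithinAt.congr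
    (fun _ hy => onEdge_of_mem _ _ hy) (onEdge_of_mem _ _ hx)

lemma diff_wave (t : ℝ) (a b : E → ℂ) : Γ.Diff (Γ.wave t a b) :=
  fun e _ hx => (hasDerivWithinAt_onEdge_wave t a b e hx).differentiableWithinAt

lemma D_wave (t : ℝ) (a b : E → ℂ) :
    Γ.D (Γ.wave t a b) = Γ.wave t b (fun e => -(t : ℂ) ^ 2 * a e) := by
  funext e x
  exact (hasDerivWithinAt_onEdge_wave t a b e x.2).derivWithin
    (uniqueDiffOn_Icc (Γ.length_pos e) x x.2)

lemma D_D_wave (t : ℝ) (a b : E → ℂ) (e : E) (x : Icc 0 (Γ.length e)) :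
    -Γ.D (Γ.D (Γ.wave t a b)) e x = ((t ^ 2 : ℝ) : ℂ) * Γ.wave t a b e x := by
  rw [D_wave, D_wave]
  simp only [wave, waveSol]
  push_cast
  ring

lemma hasDerivWithinAt_onEdge_D {f : Γ.Fn} {lam : ℝ} (h2 : Γ.Diff (Γ.D f))
    (h3 : ∀ e x, -Γ.D (Γ.D f) e x = (lam : ℂ) * f e x) (e : E) {x : ℝ}
    (hx : x ∈ Icc 0 (Γ.length e)) :
    HasDerivWithinAt (Γ.onEdge (Γ.D f) e) (-(lam : ℂ) * Γ.onEdge f e x)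
      (Icc 0 (Γ.length e)) x := by
  convert hasDerivWithinAt_onEdge h2 e hx using 1
  rw [onEdge_of_mem _ _ hx, onEdge_of_mem _ _ hx, neg_mul, ← h3, neg_neg]

/-- A solution of the eigenvalue equation on the edges is a wave. -/
lemma eq_wave {f : Γ.Fn} {t : ℝ} (h1 : Γ.Diff f) (h2 : Γ.Diff (Γ.D f))
    (h3 : ∀ e x, -Γ.D (Γ.D f) e x = ((t ^ 2 : ℝ) : ℂ) * f e x) :
    f = Γ.wave t (fun e => Γ.onEdge f e 0) (fun e => Γ.onEdge (Γ.D f) e 0) := by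
  funext e x
  have := eq_fundamental_solutions (t := t) (fun y hy => hasDerivWithinAt_onEdge h1 e hy)
    (fun y hy => by simpa using hasDerivWithinAt_onEdge_D h2 h3 e hy) x.2
  rwa [onEdge_of_mem _ _ x.2] at this

lemma endValue_wave_false (t : ℝ) (a b : E → ℂ) (e : E) :
    Γ.endValue (Γ.wave t a b) (e, false) = a e := by
  simp [endValue, endPoint, wave, waveSol_zero]

lemma endValue_wave_true (t : ℝ) (a b : E → ℂ) (e : E) :
    Γ.endValue (Γ.wave t a b) (e, true) = waveSol t (a e) (b e) (Γ.length e) := by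
  simp [endValue, endPoint, wave]

lemma endDeriv_wave_false (t : ℝ) (a b : E → ℂ) (e : E) :
    Γ.endDeriv (Γ.wave t a b) (e, false) = b e := by
  simp [endDeriv, endPoint, D_wave, wave, waveSol_zero]

lemma endDeriv_wave_true (t : ℝ) (a b : E → ℂ) (e : E) :
    Γ.endDeriv (Γ.wave t a b) (e, true) =
      -waveSol t (b e) (-(t : ℂ) ^ 2 * a e) (Γ.length e) := by
  simp [endDeriv, endPoint, D_wave, wave]

/-! ### Eigenfunctions and the kernel of the node operator -/

/-- The values of the wave at the division points are given by `x`. -/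
def Interpolates (t : ℝ) (a b : E → ℂ) (x : Γ.NodeSpace p) : Prop :=
  ∀ e, ∀ i ≤ p e, Γ.nodeVal x e i = waveSol t (a e) (b e) (i * Γ.pieceLength p e)

variable {t : ℝ} {a b : E → ℂ} {x : Γ.NodeSpace p}

/-- The value at a vertex. -/
noncomputable def vertexVal (x : Γ.NodeSpace p) (v : V) : ℂ :=
  (Γ.vertexNode p v).elim 0 fun w => x w

lemma Interpolates.endValue (hp : ∀ e, 0 < p e) (hx : Interpolates t a b x) (h : E × Bool) :
    Γ.endValue (Γ.wave t a b) h = vertexVal x (Γ.endVertex h) := by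
  obtain ⟨e, c⟩ := h
  cases c
  · have := hx e 0 (Nat.zero_le _)
    rw [endValue_wave_false]
    simpa [nodeVal, node_zero, waveSol_zero, vertexVal, endVertex] using this.symm
  · have := hx e (p e) le_rfl
    rw [Γ.mul_pieceLength (hp e)] at this
    rw [endValue_wave_true, ← this]
    simp [nodeVal, Γ.node_last (hp e), vertexVal, endVertex]

variable [Fintype E]

/-- Every eigenfunction is a wave with some vector of node values. -/
lemma exists_interpolates_of_mem_eigenspace (hp : ∀ e, 0 < p e) {f : Γ.Fn}
    (hf : f ∈ Γ.eigenspace (t ^ 2)) :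
    ∃ (a b : E → ℂ) (x : Γ.NodeSpace p), f = Γ.wave t a b ∧ Interpolates t a b x := by
  obtain ⟨h1, h2, h3, h4⟩ := hf
  have hfw := eq_wave h1 h2 h3
  set a : E → ℂ := fun e => Γ.onEdge f e 0
  set b : E → ℂ := fun e => Γ.onEdge (Γ.D f) e 0
  -- At a vertex the value is read off at an arbitrary attached end; the Neumann continuity
  -- condition makes the choice harmless.
  let x : Γ.NodeSpace p := WithLp.toLp 2 fun w => match w with
    | .inl v => Γ.endValue f v.2.2.choose
    | .inr ⟨e, j⟩ => waveSol t (a e) (b e) ((j + 1 : ℕ) * Γ.pieceLength p e)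
  have hvert : ∀ h : E × Bool, vertexVal x (Γ.endVertex h) = Γ.endValue f h := by
    intro h
    cases hv : Γ.cond (Γ.endVertex h) with
    | neumann =>
      have hv' : Γ.cond (Γ.endVertex h) = .neumann ∧
        ∃ h' : E × Bool, Γ.endVertex h' = Γ.endVertex h := ⟨hv, h, rfl⟩
      have : vertexVal x (Γ.endVertex h) = Γ.endValue f hv'.2.choose := by
        simp only [vertexVal, vertexNode, dif_pos hv', Option.elim_some]
        rfl
      rw [this]
      have h5 := h4 (Γ.endVertex h)
      rw [hv] at h5
      exact h5.1 _ _ hv'.2.choose_spec rfl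
    | dirichlet =>
      have h5 := h4 (Γ.endVertex h)
      rw [hv] at h5
      rw [h5 h rfl]
      simp [vertexVal, vertexNode, hv]
  refine ⟨a, b, x, hfw, fun e i hi => ?_⟩
  rcases Nat.eq_zero_or_pos i with rfl | hi0
  · have := hvert (e, false)
    rw [hfw, endValue_wave_false] at this
    simpa [nodeVal, node_zero, waveSol_zero, vertexVal, endVertex] using this
  rcases hi.eq_or_lt with rfl | hi'
  · have := hvert (e, true)
    rw [hfw, endValue_wave_true] at this
    rw [Γ.mul_pieceLength (hp e), ← this]
    simp [nodeVal, Γ.node_last (hp e), vertexVal, endVertex]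
  · obtain ⟨j, rfl⟩ : ∃ j : Fin (p e - 1), i = j + 1 := ⟨⟨i - 1, by omega⟩, by simp; omega⟩
    rw [nodeVal, node_succ, Option.elim_some]

variable [Fintype V]

/-- On the piece next to the vertex, the coefficients of `nodeOp` express the outgoing derivative,
up to sign, through the two end values. A loop enters once from each end. -/
lemma sum_endDeriv_wave (hp : ∀ e, 0 < p e) (ht : ∀ e, sinSol t (Γ.pieceLength p e) ≠ 0)
    (hx : Interpolates t a b x) (v : Γ.ActiveVertex) :
    ∑ h : E × Bool with Γ.endVertex h = v, Γ.endDeriv (Γ.wave t a b) h =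
      -Γ.nodeOp p t x (.inl v) := by
  rw [Γ.nodeOp_apply_inl hp, Finset.sum_filter, Fintype.sum_prod_type, ← Finset.sum_neg_distrib]
  refine Finset.sum_congr rfl fun e _ => ?_
  have hpe := hp e
  rw [Fintype.sum_bool, neg_add, add_comm]
  have h0 : Γ.nodeVal x e 0 = a e := by simpa [waveSol_zero] using hx e 0 (Nat.zero_le _)
  have h1 : Γ.nodeVal x e 1 = waveSol t (a e) (b e) (Γ.pieceLength p e) := by
    simpa using hx e 1 hpe
  have h2 := hx e (p e) le_rfl
  have h3 := hx e (p e - 1) (by omega)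
  have h4 : ((p e - 1 : ℕ) : ℝ) * Γ.pieceLength p e + Γ.pieceLength p e = Γ.length e := by
    rw [← Γ.mul_pieceLength hpe, Nat.cast_sub hpe]; push_cast; ring
  rw [Γ.mul_pieceLength hpe] at h2
  congr 1
  · simp only [endVertex, Bool.false_eq_true, if_false]
    split_ifs
    · rw [endDeriv_wave_false, h0, h1, neg_sub, ← waveSol_deriv_left (ht e)]
    · simp
  · simp only [endVertex, if_true]
    split_ifs
    · rw [endDeriv_wave_true, h2, h3, ← h4, waveSol_deriv_right (ht e)]
    · simp

lemma nodeOp_apply_inr_of_interpolates (hx : Interpolates t a b x) (e : E) (j : Fin (p e - 1)) :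
    Γ.nodeOp p t x (.inr ⟨e, j⟩) = 0 := by
  rw [nodeOp_apply_inr, hx e j (by omega), hx e (j + 1) (by omega), hx e (j + 2) (by omega)]
  have h1 : ((j + 1 : ℕ) : ℝ) * Γ.pieceLength p e = j * Γ.pieceLength p e + Γ.pieceLength p e := by
    push_cast; ring
  have h2 : ((j + 2 : ℕ) : ℝ) * Γ.pieceLength p e =
      j * Γ.pieceLength p e + Γ.pieceLength p e + Γ.pieceLength p e := by
    push_cast; ring
  rw [h1, h2, waveSol_add_waveSol]
  simp only [diagCoeff, endCoeff]
  push_cast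
  ring

/-- Continuity and the Dirichlet conditions are built into the nodes, and interior rows vanish for
any wave; only the derivative sums at active vertices remain to be tested. -/
lemma Interpolates.wave_mem_eigenspace_iff (hp : ∀ e, 0 < p e)
    (ht : ∀ e, sinSol t (Γ.pieceLength p e) ≠ 0) (hx : Interpolates t a b x) :
    Γ.wave t a b ∈ Γ.eigenspace (t ^ 2) ↔ Γ.nodeOp p t x = 0 := by
  constructor
  · rintro ⟨-, -, -, h4⟩
    ext w
    rcases w with v | ⟨e, j⟩
    · have := h4 v
      rw [v.2.1] at this
      exact neg_eq_zero.1 ((sum_endDeriv_wave hp ht hx v).symm.trans this.2)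
    · exact nodeOp_apply_inr_of_interpolates hx e j
  · intro h
    refine ⟨diff_wave _ _ _, by rw [D_wave]; exact diff_wave _ _ _, D_D_wave t a b, fun v => ?_⟩
    cases hv : Γ.cond v with
    | neumann =>
      refine ⟨fun h h' e e' => ?_, ?_⟩
      · rw [hx.endValue hp, hx.endValue hp, e, e']
      · by_cases hv' : ∃ h : E × Bool, Γ.endVertex h = v
        · rw [sum_endDeriv_wave hp ht hx ⟨v, hv, hv'⟩, h]
          simp
        · exact Finset.sum_eq_zero fun h hh => absurd ⟨h, (Finset.mem_filter.1 hh).2⟩ hv'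
    | dirichlet =>
      intro h e
      rw [hx.endValue hp, e]
      simp [vertexVal, vertexNode, hv]

variable (Γ p t) in
/-- The wave with given values at the first two division points of every edge. -/
noncomputable def waveOfNodes : Γ.NodeSpace p →ₗ[ℂ] Γ.Fn where
  toFun x := Γ.wave t (fun e => Γ.nodeVal x e 0) (fun e =>
    endCoeff t (Γ.pieceLength p e) * Γ.nodeVal x e 1
      - diagCoeff t (Γ.pieceLength p e) * Γ.nodeVal x e 0)
  map_add' x y := by
    funext e s
    simp only [wave, waveSol, nodeVal_add, Pi.add_apply]
    ring
  map_smul' c x := by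
    funext e s
    simp only [wave, waveSol, nodeVal_smul, Pi.smul_apply, RingHom.id_apply, smul_eq_mul]
    ring

/-- A vector in the kernel of the node operator is interpolated by its wave. -/
lemma interpolates_waveOfNodes (ht : ∀ e, sinSol t (Γ.pieceLength p e) ≠ 0)
    (hx : Γ.nodeOp p t x = 0) :
    Interpolates t (fun e => Γ.nodeVal x e 0) (fun e =>
      endCoeff t (Γ.pieceLength p e) * Γ.nodeVal x e 1
        - diagCoeff t (Γ.pieceLength p e) * Γ.nodeVal x e 0) x := by
  intro e
  have hS : (sinSol t (Γ.pieceLength p e) : ℂ) ≠ 0 := by exact_mod_cast ht e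
  intro i
  -- The wave is fitted to the first two nodes of the edge, and the interior rows of the kernel
  -- equation propagate the agreement.
  induction i using Nat.twoStepInduction with
  | zero => intro _; simp [waveSol_zero]
  | one =>
    intro _
    simp only [waveSol, diagCoeff, endCoeff, Nat.cast_one, one_mul]
    push_cast
    field_simp
    ring
  | more i ih1 ih2 =>
    intro hi
    have h1 := ih1 (by omega)
    have h2 := ih2 (by omega)
    have h3 : Γ.nodeOp p t x (.inr ⟨e, ⟨i, by omega⟩⟩) = 0 := by rw [hx]; rfl
    rw [nodeOp_apply_inr] at h3
    have h4 := waveSol_add_waveSol t (Γ.nodeVal x e 0)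
      (endCoeff t (Γ.pieceLength p e) * Γ.nodeVal x e 1
        - diagCoeff t (Γ.pieceLength p e) * Γ.nodeVal x e 0)
      (i * Γ.pieceLength p e) (Γ.pieceLength p e)
    have e1 : (i * Γ.pieceLength p e) + Γ.pieceLength p e = (i + 1 : ℕ) * Γ.pieceLength p e := by
      push_cast; ring
    have e2 : ((i + 1 : ℕ) * Γ.pieceLength p e) + Γ.pieceLength p e =
        (i + 2 : ℕ) * Γ.pieceLength p e := by
      push_cast; ring
    rw [e1, e2, ← h1, ← h2] at h4
    have h5 : 2 * cosSol t (Γ.pieceLength p e) * Γ.nodeVal x e (i + 1) =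
        Γ.nodeVal x e i + Γ.nodeVal x e (i + 2) := by
      simp only [diagCoeff, endCoeff] at h3
      push_cast at h3
      field_simp at h3
      linear_combination h3
    linear_combination -h4 - h5

lemma map_waveOfNodes_ker (hp : ∀ e, 0 < p e) (ht : ∀ e, sinSol t (Γ.pieceLength p e) ≠ 0) :
    (LinearMap.ker (Γ.nodeOp p t)).map (Γ.waveOfNodes p t) = Γ.eigenspace (t ^ 2) := by
  apply le_antisymm
  · rintro _ ⟨x, hx, rfl⟩
    exact ((interpolates_waveOfNodes ht hx).wave_mem_eigenspace_iff hp ht).2 hx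
  · intro f hf
    obtain ⟨a, b, x, rfl, hx⟩ := exists_interpolates_of_mem_eigenspace hp hf
    refine ⟨x, (hx.wave_mem_eigenspace_iff hp ht).1 hf, ?_⟩
    have h0 : ∀ e, Γ.nodeVal x e 0 = a e := fun e => by
      simpa [waveSol_zero] using hx e 0 (Nat.zero_le _)
    have h1 : ∀ e, Γ.nodeVal x e 1 = waveSol t (a e) (b e) (Γ.pieceLength p e) := fun e => by
      simpa using hx e 1 (hp e)
    change Γ.wave t _ _ = Γ.wave t a b
    simp only [h0, h1, ← waveSol_deriv_left (ht _)]

/-- For a kernel vector the node values are samples of its wave, and every node lies on some edge.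
-/
lemma injective_waveOfNodes_ker (hp : ∀ e, 0 < p e) (ht : ∀ e, sinSol t (Γ.pieceLength p e) ≠ 0) :
    Function.Injective ((Γ.waveOfNodes p t).domRestrict (LinearMap.ker (Γ.nodeOp p t))) := by
  rw [← LinearMap.ker_eq_bot, LinearMap.ker_eq_bot']
  rintro ⟨x, hx⟩ h0
  have hx' := interpolates_waveOfNodes ht hx
  have hval : ∀ e, ∀ i ≤ p e, Γ.nodeVal x e i = 0 := by
    intro e i hi
    rw [hx' e i hi]
    have hpos := Γ.pieceLength_pos (hp e)
    have hmem : (i : ℝ) * Γ.pieceLength p e ∈ Icc 0 (Γ.length e) := by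
      refine ⟨by positivity, ?_⟩
      rw [← Γ.mul_pieceLength (hp e)]
      gcongr
    exact congrFun (congrFun h0 e) ⟨_, hmem⟩
  ext w
  obtain ⟨e, i, hi, h⟩ := Γ.exists_node_eq hp w
  rcases h with h | h
  · simpa [nodeVal, h] using hval e i hi.le
  · simpa [nodeVal, h] using hval e (i + 1) hi

/-- Eigenfunctions correspond to the kernel of the node operator. -/
noncomputable def kerEquivEigenspace (hp : ∀ e, 0 < p e)
    (ht : ∀ e, sinSol t (Γ.pieceLength p e) ≠ 0) :
    LinearMap.ker (Γ.nodeOp p t) ≃ₗ[ℂ] Γ.eigenspace (t ^ 2) :=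
  (LinearEquiv.ofInjective _ (injective_waveOfNodes_ker hp ht)).trans
    (LinearEquiv.ofEq _ _ (by
      rw [LinearMap.range_domRestrict, map_waveOfNodes_ker hp ht]))

/-- There are no negative eigenvalues. -/
lemma eigenspace_eq_bot_of_neg {lam : ℝ} (hlam : lam < 0) : Γ.eigenspace lam = ⊥ := by
  rw [eq_bot_iff]
  rintro f ⟨h1, h2, h3, h4⟩
  have key := fun e => re_conj_mul_deriv_le hlam (Γ.length_pos e)
    (fun y hy => hasDerivWithinAt_onEdge h1 e hy)
    (fun y hy => hasDerivWithinAt_onEdge_D h2 h3 e hy)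
  -- Either vertex condition kills the boundary terms of integration by parts: a common value
  -- factors out, or every value is zero.
  have hzero : ∀ v, ∑ h : E × Bool with Γ.endVertex h = v,
      starRingEnd ℂ (Γ.endValue f h) * Γ.endDeriv f h = 0 := by
    intro v
    have hv := h4 v
    cases hc : Γ.cond v with
    | neumann =>
      rw [hc] at hv
      by_cases hex : ∃ h : E × Bool, Γ.endVertex h = v
      · obtain ⟨h₀, hh₀⟩ := hex
        have : ∀ h ∈ Finset.univ.filter fun h : E × Bool => Γ.endVertex h = v,
            starRingEnd ℂ (Γ.endValue f h) * Γ.endDeriv f h =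
              starRingEnd ℂ (Γ.endValue f h₀) * Γ.endDeriv f h := fun h hh => by
          rw [hv.1 h h₀ (Finset.mem_filter.1 hh).2 hh₀]
        rw [Finset.sum_congr rfl this, ← Finset.mul_sum, hv.2, mul_zero]
      · exact Finset.sum_eq_zero fun h hh => absurd ⟨h, (Finset.mem_filter.1 hh).2⟩ hex
    | dirichlet =>
      rw [hc] at hv
      refine Finset.sum_eq_zero fun h hh => ?_
      rw [hv h (Finset.mem_filter.1 hh).2, map_zero, zero_mul]
  have htot : ∑ h : E × Bool, starRingEnd ℂ (Γ.endValue f h) * Γ.endDeriv f h = 0 := by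
    rw [← Finset.sum_fiberwise Finset.univ Γ.endVertex]
    exact Finset.sum_eq_zero fun v _ => hzero v
  rw [Fintype.sum_prod_type] at htot
  have hl : ∀ e, (0 : ℝ) ∈ Icc 0 (Γ.length e) := fun e => ⟨le_rfl, (Γ.length_pos e).le⟩
  have hr : ∀ e, Γ.length e ∈ Icc 0 (Γ.length e) := fun e => ⟨(Γ.length_pos e).le, le_rfl⟩
  have hsum : ∑ e, ((starRingEnd ℂ (Γ.onEdge f e (Γ.length e)) *
      Γ.onEdge (Γ.D f) e (Γ.length e)).re -
      (starRingEnd ℂ (Γ.onEdge f e 0) * Γ.onEdge (Γ.D f) e 0).re) = 0 := by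
    have := congrArg (fun z : ℂ => -z.re) htot
    simp only [Complex.re_sum, Complex.zero_re, neg_zero, ← Finset.sum_neg_distrib] at this
    refine Eq.trans (Finset.sum_congr rfl fun e _ => ?_) this
    rw [Fintype.sum_bool, onEdge_of_mem _ _ (hl e), onEdge_of_mem _ _ (hr e),
      onEdge_of_mem _ _ (hl e), onEdge_of_mem _ _ (hr e)]
    simp only [endValue, endDeriv, endPoint, if_true, Bool.false_eq_true, if_false, mul_neg,
      Complex.neg_re]
    ring
  -- The increments over the edges are nonnegative and sum to zero, so each is zero, which forces `f
  -- = 0` edge by edge.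
  have hz := (Finset.sum_eq_zero_iff_of_nonneg fun e _ => sub_nonneg.2 (key e).1).1 hsum
  rw [Submodule.mem_bot]
  funext e y
  have := (key e).2 (sub_eq_zero.1 (hz e (Finset.mem_univ e))).symm y y.2
  rwa [onEdge_of_mem _ _ y.2] at this

end QuantumGraph

end Eigenfunctions

/-! ### The counting function and its two bounds. -/

section Counting

open Set Module
open scoped InnerProductSpace Classical

namespace QuantumGraph

variable {V E : Type*} (Γ : QuantumGraph V E) {p : E → ℕ} {k : ℝ}

/-! ### Counting eigenvalues -/

lemma sinSol_pieceLength_ne_zero (hp : ∀ e, 0 < p e)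
    (hk : ∀ e, k * Γ.pieceLength p e < Real.pi) {t : ℝ} (ht : t ∈ Icc 0 k) (e : E) :
    sinSol t (Γ.pieceLength p e) ≠ 0 := by
  have hpos := Γ.pieceLength_pos (hp e)
  exact (sinSol_pos ht.1 hpos ((mul_le_mul_of_nonneg_right ht.2 hpos.le).trans_lt (hk e))).ne'

variable [Fintype V] [Fintype E]

/-- The counting function is the number of nonpositive eigenvalues of the node operator. -/
theorem counting_eq_card_eigenvalues_nonpos (hp : ∀ e, 0 < p e) (hk0 : 0 ≤ k)
    (hk : ∀ e, k * Γ.pieceLength p e < Real.pi) :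
    (Γ.eigenvalues ∩ Iic (k ^ 2)).Finite ∧ Γ.counting k = Finset.card {j |
      (Γ.nodeOp_isSymmetric p k).eigenvalues (n := Fintype.card (Γ.Node p))
        finrank_euclideanSpace j ≤ 0} := by
  have hpiece := fun e => Γ.pieceLength_pos (hp e)
  obtain ⟨hfin, hsum⟩ := sum_finrank_ker_eq_card_eigenvalues_nonpos (Γ.nodeOp_isSymmetric p)
    (finrank_euclideanSpace (𝕜 := ℂ) (ι := Γ.Node p)) hk0 (Γ.continuousOn_nodeOp hp hk)
    (fun s hs t ht hst x hx => Γ.re_inner_nodeOp_lt hp hs.1 hst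
      (fun e => (mul_le_mul_of_nonneg_right ht.2 (hpiece e).le).trans_lt (hk e)) hx)
    (Γ.re_inner_nodeOp_zero_nonneg hp)
  have hequiv := fun (t : ℝ) (ht : t ∈ Icc 0 k) =>
    kerEquivEigenspace hp (Γ.sinSol_pieceLength_ne_zero hp hk ht)
  -- As there are no negative eigenvalues, `t ↦ t²` matches the crossing times in `[0, k]` with the
  -- eigenvalues up to `k²`.
  have himg : Γ.eigenvalues ∩ Iic (k ^ 2) =
      (fun t => t ^ 2) '' {t ∈ Icc 0 k | LinearMap.ker (Γ.nodeOp p t) ≠ ⊥} := by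
    ext lam
    constructor
    · rintro ⟨h1, h2⟩
      have h0 : 0 ≤ lam := by
        by_contra! hneg
        exact h1 (eigenspace_eq_bot_of_neg hneg)
      have hmem : Real.sqrt lam ∈ Icc 0 k := ⟨Real.sqrt_nonneg _, Real.sqrt_le_iff.2 ⟨hk0, h2⟩⟩
      refine ⟨Real.sqrt lam, ⟨hmem, fun hbot => h1 ?_⟩, Real.sq_sqrt h0⟩
      have e := hequiv _ hmem
      rw [Real.sq_sqrt h0, hbot] at e
      have := e.symm.toEquiv.subsingleton
      exact (Submodule.subsingleton_iff_eq_bot).1 this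
    · rintro ⟨t, ⟨ht, hne⟩, rfl⟩
      refine ⟨fun hbot => hne ?_, pow_le_pow_left₀ ht.1 ht.2 2⟩
      have e := hequiv _ ht
      change Γ.eigenspace (t ^ 2) = ⊥ at hbot
      rw [hbot] at e
      have := e.toEquiv.subsingleton
      exact (Submodule.subsingleton_iff_eq_bot).1 this
  refine ⟨himg ▸ hfin.image _, ?_⟩
  rw [← hsum, counting, himg, finsum_mem_image]
  · exact finsum_mem_congr rfl fun t ht => (hequiv t ht.1).finrank_eq.symm
  · intro s hs t ht hst
    exact (pow_left_inj₀ hs.1.1 ht.1.1 two_ne_zero).1 hst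

lemma card_node_le (p : E → ℕ) :
    Fintype.card (Γ.Node p) ≤ Fintype.card V + ∑ e, (p e - 1) := by
  rw [Fintype.card_sum, Fintype.card_sigma]
  simp only [Fintype.card_fin]
  gcongr
  exact Fintype.card_subtype_le _

/-- The strict inequality needs the `+ 1`: if `k * l / π` is a positive integer, that many pieces
would have phase exactly `π`. -/
lemma mul_div_floor_add_one_lt (k l : ℝ) :
    k * (l / (⌊k * l / Real.pi⌋₊ + 1 : ℕ)) < Real.pi := by
  have h := Nat.lt_floor_add_one (k * l / Real.pi)
  rw [div_lt_iff₀ Real.pi_pos] at h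
  rw [← mul_div_assoc, div_lt_iff₀ (by positivity)]
  push_cast
  linarith

/-- `N(k)` cannot exceed the dimension of the node space, and an edge cut into `⌊k L_e / π⌋ + 1`
pieces has `⌊k L_e / π⌋` interior nodes. -/
theorem counting_le (hk : 0 ≤ k) :
    (Γ.eigenvalues ∩ Iic (k ^ 2)).Finite ∧
      (Γ.counting k : ℝ) ≤ Γ.totalLength / Real.pi * k + Fintype.card V := by
  obtain ⟨hfin, hcount⟩ := Γ.counting_eq_card_eigenvalues_nonpos
    (p := fun e => ⌊k * Γ.length e / Real.pi⌋₊ + 1) (fun e => Nat.succ_pos _) hk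
    (fun e => mul_div_floor_add_one_lt k (Γ.length e))
  refine ⟨hfin, ?_⟩
  have h1 : Γ.counting k ≤ Fintype.card V + ∑ e, ⌊k * Γ.length e / Real.pi⌋₊ := by
    rw [hcount]
    refine (Finset.card_le_univ _).trans ?_
    rw [Fintype.card_fin]
    exact Γ.card_node_le _
  have h2 : (Γ.counting k : ℝ) ≤ Fintype.card V + ∑ e, (⌊k * Γ.length e / Real.pi⌋₊ : ℝ) := by
    exact_mod_cast h1
  have h3 : ∑ e, (⌊k * Γ.length e / Real.pi⌋₊ : ℝ) ≤ ∑ e, k * Γ.length e / Real.pi :=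
    Finset.sum_le_sum fun e _ => Nat.floor_le
      (div_nonneg (mul_nonneg hk (Γ.length_pos e).le) Real.pi_pos.le)
  have h4 : ∑ e, k * Γ.length e / Real.pi = Γ.totalLength / Real.pi * k := by
    rw [totalLength, ← Finset.sum_div, ← Finset.mul_sum]; ring
  linarith

/-- Placing `m e` hat functions next to each other on the edge `e`, all of them of nonpositive
energy, bounds the number of nonpositive eigenvalues from below. -/
lemma sum_le_counting (hk : 0 ≤ k) {m : E → ℕ} (h1 : ∀ e, m e * Real.pi ≤ k * Γ.length e)
    (h2 : ∀ e, k * Γ.length e < (m e + 1) * Real.pi) : ∑ e, m e ≤ Γ.counting k := by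
  -- With `2 m` pieces each phase `k l` lies in `[π/2, π)`; the maximum keeps one piece on edges
  -- with `m = 0`.
  set p : E → ℕ := fun e => max 1 (2 * m e) with hpdef
  have hp : ∀ e, 0 < p e := fun e => lt_max_of_lt_left one_pos
  have hlen : ∀ e, k * Γ.pieceLength p e < Real.pi := by
    intro e
    have hpe : (0 : ℝ) < p e := by exact_mod_cast hp e
    rw [pieceLength, ← mul_div_assoc, div_lt_iff₀ hpe]
    refine (h2 e).trans_le ?_
    rw [mul_comm]
    have : m e + 1 ≤ p e := by simp only [hpdef]; omega
    have : (m e : ℝ) + 1 ≤ p e := by exact_mod_cast this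
    gcongr
  rw [(Γ.counting_eq_card_eigenvalues_nonpos hp hk hlen).2]
  -- Interior nodes are numbered from zero, so index `2 i` is the odd division point `2 i + 1`. All
  -- even division points and all vertices then carry the value zero.
  let hat : (Σ e, Fin (m e)) → Γ.Node p := fun w =>
    .inr ⟨w.1, ⟨2 * w.2, by simp only [hpdef]; omega⟩⟩
  have hinj : Function.Injective hat := by
    rintro ⟨e, i⟩ ⟨e', i'⟩ h
    simp only [hat, Sum.inr.injEq, Sigma.mk.injEq] at h
    obtain ⟨rfl, h⟩ := h
    have := congrArg Fin.val (eq_of_heq h)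
    simp only at this
    congr 1
    apply Fin.ext
    omega
  have hli : LinearIndependent ℂ
      fun w => ((EuclideanSpace.basisFun (Γ.Node p) ℂ).toBasis (hat w)) :=
    (EuclideanSpace.basisFun (Γ.Node p) ℂ).toBasis.linearIndependent.comp hat hinj
  have hrank := finrank_span_eq_card hli
  rw [Fintype.card_sigma] at hrank
  simp only [Fintype.card_fin] at hrank
  rw [← hrank]
  refine (Γ.nodeOp_isSymmetric p k).finrank_le_card_eigenvalues_nonpos _ _ fun x hx => ?_
  have hzero : ∀ w, w ∉ range hat → x w = 0 := by
    intro w hw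
    induction hx using Submodule.span_induction with
    | mem y hy =>
      obtain ⟨u, rfl⟩ := hy
      simp only [OrthonormalBasis.coe_toBasis, EuclideanSpace.basisFun_apply, PiLp.single_apply]
      rw [if_neg]
      rintro rfl
      exact hw ⟨u, rfl⟩
    | zero => rfl
    | add y z _ _ hy hz => rw [PiLp.add_apply, hy, hz, add_zero]
    | smul c y _ hy => rw [PiLp.smul_apply, hy, smul_zero]
  have hvertex : ∀ v, (Γ.vertexNode p v).elim 0 (fun w => x w) = 0 := by
    intro v
    unfold vertexNode
    split_ifs
    · exact hzero _ (by simp [hat])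
    · rfl
  have heven : ∀ e i, Even i → Γ.nodeVal x e i = 0 := by
    intro e i hi
    unfold nodeVal node
    split_ifs with hi0 hlt
    · exact hvertex _
    · refine hzero _ ?_
      rintro ⟨⟨e', j⟩, h⟩
      simp only [hat, Sum.inr.injEq, Sigma.mk.injEq] at h
      obtain ⟨rfl, h⟩ := h
      have := congrArg Fin.val (eq_of_heq h)
      simp only at this
      obtain ⟨r, rfl⟩ := hi
      omega
    · exact hvertex _
  rw [re_inner_nodeOp]
  refine Finset.sum_nonpos fun e _ => Finset.sum_nonpos fun i hi => ?_
  rcases Nat.eq_zero_or_pos (m e) with hm | hm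
  · have hp1 : p e = 1 := by simp [hpdef, hm]
    have hi0 : i = 0 := by
      have := Finset.mem_range.1 hi
      omega
    have e1 : Γ.nodeVal x e 1 = 0 := by
      have := hvertex (Γ.tgt e)
      rwa [← Γ.node_last (hp e), hp1] at this
    rw [hi0, heven e 0 Even.zero, e1]
    simp [pieceForm]
  · refine pieceForm_nonpos hk (Γ.pieceLength_pos (hp e)) ?_ (hlen e) ?_
    · have hp2 : (p e : ℝ) = 2 * m e := by
        have : p e = 2 * m e := by simp only [hpdef]; omega
        exact_mod_cast this
      have hm' : (0 : ℝ) < m e := by exact_mod_cast hm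
      rw [pieceLength, hp2, ← mul_div_assoc, le_div_iff₀ (by positivity)]
      linarith [h1 e]
    -- Of two consecutive division points one is even, so every piece has an end with value zero.
    · rcases Nat.even_or_odd i with h | h
      · exact .inl (heven e i h)
      · exact .inr (heven e (i + 1) h.add_one)

theorem le_counting (hk : 0 ≤ k) :
    Γ.totalLength / Real.pi * k - Fintype.card E ≤ (Γ.counting k : ℝ) := by
  have hnn : ∀ e, 0 ≤ k * Γ.length e / Real.pi := fun e =>
    div_nonneg (mul_nonneg hk (Γ.length_pos e).le) Real.pi_pos.le
  have h1 := Γ.sum_le_counting hk (m := fun e => ⌊k * Γ.length e / Real.pi⌋₊)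
    (fun e => (le_div_iff₀ Real.pi_pos).1 (Nat.floor_le (hnn e)))
    (fun e => (div_lt_iff₀ Real.pi_pos).1 (Nat.lt_floor_add_one _))
  have h2 : ∑ e, (⌊k * Γ.length e / Real.pi⌋₊ : ℝ) ≤ Γ.counting k := by exact_mod_cast h1
  have h3 : ∑ e, (k * Γ.length e / Real.pi - 1) ≤ ∑ e, (⌊k * Γ.length e / Real.pi⌋₊ : ℝ) :=
    Finset.sum_le_sum fun e _ => by linarith [Nat.lt_floor_add_one (k * Γ.length e / Real.pi)]
  have h4 : ∑ e, (k * Γ.length e / Real.pi - 1) =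
      Γ.totalLength / Real.pi * k - Fintype.card E := by
    rw [Finset.sum_sub_distrib, totalLength, ← Finset.sum_div, ← Finset.mul_sum]
    simp only [Finset.sum_const, Finset.card_univ, nsmul_eq_mul, mul_one]
    ring
  linarith

/-- Needed for `counting` to mean what it should: `finrank` is zero by default on an
infinite-dimensional space. -/
theorem finiteDimensional_eigenspace (lam : ℝ) : FiniteDimensional ℂ (Γ.eigenspace lam) := by
  rcases lt_or_ge lam 0 with h | h
  · rw [eigenspace_eq_bot_of_neg h]
    infer_instance
  · have hp : ∀ e, 0 < ⌊Real.sqrt lam * Γ.length e / Real.pi⌋₊ + 1 := fun e => Nat.succ_pos _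
    have e := kerEquivEigenspace hp (Γ.sinSol_pieceLength_ne_zero hp
      (fun e => mul_div_floor_add_one_lt (Real.sqrt lam) (Γ.length e))
      ⟨Real.sqrt_nonneg lam, le_rfl⟩)
    rw [Real.sq_sqrt h] at e
    exact Module.Finite.equiv e

end QuantumGraph

end Counting

/-- Weyl's law. The first two conjuncts say that the counting function counts finitely many
eigenvalues of finite multiplicity. -/
theorem mainTheorem3 {V E : Type*} [Fintype V] [Fintype E] (Γ : QuantumGraph V E) :
    (∀ lam : ℝ, FiniteDimensional ℂ (Γ.eigenspace lam)) ∧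
    (∀ k : ℝ, (Γ.eigenvalues ∩ Set.Iic (k ^ 2)).Finite) ∧
    (∃ C : ℝ, ∀ k : ℝ, 0 ≤ k →
      |(Γ.counting k : ℝ) - Γ.totalLength / Real.pi * k| ≤ C) ∧
    ∀ k : ℝ, 0 ≤ k →
      Γ.totalLength / Real.pi * k - Fintype.card E ≤ (Γ.counting k : ℝ) ∧
      (Γ.counting k : ℝ) ≤ Γ.totalLength / Real.pi * k + Fintype.card V := by
  refine ⟨Γ.finiteDimensional_eigenspace, fun k => ?_, ⟨Fintype.card E + Fintype.card V, ?_⟩,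
    fun k hk => ⟨Γ.le_counting hk, (Γ.counting_le hk).2⟩⟩
  -- Finiteness is claimed for negative `k` too, and depends on `k²` only.
  · have := (Γ.counting_le (abs_nonneg k)).1
    rwa [sq_abs] at this
  · intro k hk
    have h1 := Γ.le_counting hk
    have h2 := (Γ.counting_le hk).2
    have h3 : (0 : ℝ) ≤ Fintype.card E := by positivity
    have h4 : (0 : ℝ) ≤ Fintype.card V := by positivity
    rw [abs_le]
    constructor <;> linarith
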